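/- Let $p=3/2$, $a_*=-p^p(p-1)^{1-p}=-\tfrac{3\sqrt3}{2}$ and $a\in(a_*,0)$. Consider smooth, positive, nonconstant, periodic functions $\kappa:\mathbb R\to\mathbb R$ (the curvature, as a function of arc length, of a convex $p$-elastic curve in the hyperbolic plane of curvature $-1$) satisfying the Euler–Lagrange equation of $\int\kappa^p\,ds$, $$p\,\big(\kappa^{p-1}\big)''+(p-1)\kappa^{p+1}-p\,\kappa^{p-1}=0,$$ with first integral $$p^2(p-1)^2\kappa^{2(p-2)}(\kappa')^2+(p-1)^2\kappa^{2p}-p^2\kappa^{2(p-1)}=a .$$ Such $\kappa$ exist for every $a\in(a_*,0)$, each of them has a least period $\varrho>0$, and the number $$\Lambda_{p}(a)=(p-1)\sqrt{-a}\int_0^{\varrho}\frac{\kappa^{p}}{a+p^2\kappa^{2(p-1)}}\,ds$$ does not depend on the choice of $\kappa$. This defines the closure function $\Lambda_{3/2}:(-\tfrac{3\sqrt3}{2},0)\to\mathbb R$. For $0\le k<1$ and $k'=\sqrt{1-k^2}$ let $$K(k)=\int_0^1\frac{du}{\sqrt{(1-u^2)(1-k^2u^2)}},\qquad E(k)=\int_0^1\frac{\sqrt{1-k^2u^2}}{\sqrt{1-u^2}}\,du,$$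 $$F(\phi,k)=\int_0^\phi\frac{dt}{\sqrt{1-k^2\sin^2t}},\qquad E(\phi,k)=\int_0^\phi\sqrt{1-k^2\sin^2t}\,dt,$$ and let Heuman's Lambda function be $$\widehat\Lambda(\phi,k)=\frac2\pi\Big(E(k)F(\phi,k')+K(k)E(\phi,k')-K(k)F(\phi,k')\Big).$$ **Theorem.** For every $a\in(-\tfrac{3\sqrt3}{2},0)$ the polynomial $(-\kappa^3+9\kappa+4a)/4$ in $\kappa$ has exactly two positive roots $\alpha>\beta>0$, and $$\Lambda_{3/2}(a)=\frac{2\sqrt{\alpha\beta(\alpha+\beta)}}{3\sqrt{2\alpha+\beta}}\,K(\zeta)+\pi\,\widehat\Lambda\!\left(\arcsin\sqrt{\frac{\chi-\zeta^2}{\chi(1-\zeta^2)}},\,\zeta\right),$$ where $$\zeta=\sqrt{\frac{\alpha-\beta}{2\alpha+\beta}},\qquad \chi=\frac{9(\alpha-\beta)}{9\alpha-\alpha\beta(\alpha+\beta)}.$$ Moreover, $\Lambda_{3/2}$ is strictly decreasing on $(-\tfrac{3\sqrt3}{2},0)$, with $\Lambda_{3/2}(a)\to\sqrt2\,\pi$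 as $a\to-\tfrac{3\sqrt3}{2}^{+}$ and $\Lambda_{3/2}(a)\to\pi$ as $a\to0^-$. -/

import Mathlib

noncomputable section

/-- `κ` is the curvature function (in terms of the arc length parameter `s ∈ ℝ`) of a convex
`p`-elastic curve of the hyperbolic plane with nonconstant periodic curvature and constant of
integration `a`. In the hyperbolic plane both causal characters of the Frenet frame are `1`. -/
structure IsPElasticCurvature (p a : ℝ) (κ : ℝ → ℝ) : Prop where
  smooth : ContDiff ℝ (⊤ : ℕ∞) κ
  convex : ∀ s, 0 < κ s
  nonconstant : ∃ s t, κ s ≠ κ t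
  periodic : ∃ T, 0 < T ∧ Function.Periodic κ T
  /-- the Euler-Lagrange equation of `∫ κ ^ p ds` -/
  eulerLagrange : ∀ s,
    p * iteratedDeriv 2 (fun t => κ t ^ (p - 1)) s + (p - 1) * κ s ^ (p + 1)
      - p * κ s ^ (p - 1) = 0
  /-- the first integral of the Euler-Lagrange equation, with value `a` -/
  firstIntegral : ∀ s,
    p ^ 2 * (p - 1) ^ 2 * κ s ^ (2 * (p - 2)) * deriv κ s ^ 2 + (p - 1) ^ 2 * κ s ^ (2 * p)
      - p ^ 2 * κ s ^ (2 * (p - 1)) = a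

/-- `ϱ` is the least period of `κ`. -/
def IsLeastPeriod (κ : ℝ → ℝ) (ϱ : ℝ) : Prop :=
  IsLeast {T : ℝ | 0 < T ∧ Function.Periodic κ T} ϱ

/-- The angular progression along the parameter interval `[0, ϱ]` of the curve with curvature
`κ` and constant of integration `a`. -/
def angularProgression (p a : ℝ) (κ : ℝ → ℝ) (ϱ : ℝ) : ℝ :=
  (p - 1) * Real.sqrt (-a) *
    ∫ s in (0 : ℝ)..ϱ, κ s ^ p / (a + p ^ 2 * κ s ^ (2 * (p - 1)))

/-- `L` is the angular progression, along one least period of the curvature, of some convex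
`p`-elastic curve with nonconstant periodic curvature and constant of integration `a`. -/
def IsClosureValue (p a L : ℝ) : Prop :=
  ∃ (κ : ℝ → ℝ) (ϱ : ℝ),
    IsPElasticCurvature p a κ ∧ IsLeastPeriod κ ϱ ∧ L = angularProgression p a κ ϱ

open Classical in
/-- The closure function `Λ_p(a)` in the hyperbolic plane. The value `0` is only used when there
is no curve with parameters `p` and `a`. -/
def closureFunction (p a : ℝ) : ℝ :=
  if h : ∃ L, IsClosureValue p a L then h.choose else 0

/-- The lower end `a_*` of the interval of admissible constants of integration in the hyperbolic
plane (`p > 1`). -/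
def aStar (p : ℝ) : ℝ := -(p ^ p * (p - 1) ^ (1 - p))

/-- The complete elliptic integral of the first kind, as a function of the modulus. -/
def ellipticK (ζ : ℝ) : ℝ :=
  ∫ u in (0 : ℝ)..1, 1 / Real.sqrt ((1 - u ^ 2) * (1 - ζ ^ 2 * u ^ 2))

/-- The complete elliptic integral of the second kind, as a function of the modulus. -/
def ellipticE (ζ : ℝ) : ℝ :=
  ∫ u in (0 : ℝ)..1, Real.sqrt (1 - ζ ^ 2 * u ^ 2) / Real.sqrt (1 - u ^ 2)

/-- The incomplete elliptic integral of the first kind with amplitude `φ` and modulus `k`. -/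
def incompleteF (φ k : ℝ) : ℝ :=
  ∫ t in (0 : ℝ)..φ, 1 / Real.sqrt (1 - k ^ 2 * Real.sin t ^ 2)

/-- The incomplete elliptic integral of the second kind with amplitude `φ` and modulus `k`. -/
def incompleteE (φ k : ℝ) : ℝ :=
  ∫ t in (0 : ℝ)..φ, Real.sqrt (1 - k ^ 2 * Real.sin t ^ 2)

/-- Heuman's Lambda function with amplitude `φ` and modulus `k`; the incomplete integrals are
taken at the complementary modulus `√(1 - k²)`. -/
def heumanLambda (φ k : ℝ) : ℝ :=
  2 / Real.pi *
    (ellipticE k * incompleteF φ (Real.sqrt (1 - k ^ 2))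
      + ellipticK k * incompleteE φ (Real.sqrt (1 - k ^ 2))
      - ellipticK k * incompleteF φ (Real.sqrt (1 - k ^ 2)))

/-- The modulus `ζ` in terms of the roots `α > β > 0`. -/
def zetaMod (α β : ℝ) : ℝ := Real.sqrt ((α - β) / (2 * α + β))

/-- The characteristic `χ` in terms of the roots `α > β > 0`. -/
def chiChar (α β : ℝ) : ℝ := 9 * (α - β) / (9 * α - α * β * (α + β))

end

open Set Filter Topology MeasureTheory

/-! For p = 3/2 the function w = √κ satisfies w'' = w − w⁵/3 and 9w'² = P(κ), where P(x) = −x³ + 9x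
− c and c = −4a. The roots of P are α, β and −(α+β), so c = αβ(α+β) and α² + αβ + β² = 9; these two
relations drive the algebra throughout. Writing κ = α − (α−β) sin²θ turns the first integral into θ'
= √κ √(κ+α+β)/3 > 0, whose global flow produces a curve (`exists_elasticCurve`). Any other curve
attains the maximum α, where w' = 0, so ODE uniqueness makes it a translate
(`IsPElasticCurvature.exists_translate`). Hence the closure function equals `closureIntegral α β`.

Splitting the numerator of that integral as κ = (9κ − c)/9 + c/9 gives a multiple of K(ζ) plus a
complete integral of the third kind. The latter is Heuman's Lambda by `integral_circular_thirdKind`,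
which integrates a divergence identity over a rectangle.

Monotonicity is not visible in this form. Adding the exact differential of 2 arctan(3√P/(√c κ))
trades the factor 9κ − c for 9 − κ², which is free of a. Viète's substitution κ = √3 cos τ + 3 sin τ
gives κ(9 − κ²) = 6√3 cos 3τ. With cos 3τ = 1/(1+2y²) and c = 6√3/(1+2l²) one gets P = 12√3 (l² −
y²)/((1+2l²)(1+2y²)), and y = l sin ψ removes the square root. The part odd in ψ integrates to zero,
leaving 2√2 ∫ G(l sin ψ) dψ over [0, π/2] with G = cos 2τ / cos(3τ/2)
(`closureIntegral_eq_monotoneClosure`). Since G falls strictly from 1 to 1/√2 on [0, ∞), and l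
increases from 0 to ∞ with a, strict decrease and both limits follow. -/

noncomputable section

/-! ### Global flow of a scalar autonomous equation -/

/-- An autonomous scalar equation `θ' = g θ` with smooth, positive, periodic right-hand side has a
global solution `θ`, with inverse `T`. -/
theorem exists_smooth_flow_of_periodic {g : ℝ → ℝ} {P : ℝ} (hg : ContDiff ℝ (⊤ : ℕ∞) g)
    (hpos : ∀ x, 0 < g x) (hper : Function.Periodic g P) (hP : 0 < P) :
    ∃ T θ : ℝ → ℝ, ContDiff ℝ (⊤ : ℕ∞) θ ∧ (∀ x, HasDerivAt T (1 / g x) x) ∧ T 0 = 0 ∧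
      StrictMono T ∧ (∀ x, θ (T x) = x) ∧ (∀ s, T (θ s) = s) ∧
      (∀ s, HasDerivAt θ (g (θ s)) s) ∧ ∀ x, T (x + P) = T x + T P := by
  have hinv : ContDiff ℝ (⊤ : ℕ∞) (fun x => 1 / g x) :=
    contDiff_const.div hg fun x => (hpos x).ne'
  have hcont : Continuous fun x => 1 / g x := hinv.continuous
  have hint : ∀ a b, IntervalIntegrable (fun x => 1 / g x) volume a b :=
    fun a b => hcont.intervalIntegrable a b
  have hper' : Function.Periodic (fun x => 1 / g x) P := fun x => by simp only [hper x]
  have hpos' : ∀ x, 0 < 1 / g x := fun x => one_div_pos.2 (hpos x)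
  set T : ℝ → ℝ := fun x => ∫ u in (0 : ℝ)..x, 1 / g u with hT
  have hderiv : ∀ x, HasDerivAt T (1 / g x) x := fun x =>
    intervalIntegral.integral_hasDerivAt_right (hint 0 x)
      (hcont.stronglyMeasurableAtFilter _ _) hcont.continuousAt
  have hmono : StrictMono T := by
    refine strictMono_of_deriv_pos fun x => ?_
    rw [(hderiv x).deriv]
    exact hpos' x
  have hTc : Continuous T := continuous_iff_continuousAt.2 fun x => (hderiv x).continuousAt
  -- A positive periodic integrand has a divergent integral in both directions, so the solution
  -- never blows up and its inverse is defined on all of ℝ.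
  have hsurj : Function.Surjective T := hTc.surjective
    (hper'.tendsto_atTop_intervalIntegral_of_pos' (hint 0 P) hpos' hP)
    (hper'.tendsto_atBot_intervalIntegral_of_pos' (hint 0 P) hpos' hP)
  set e : ℝ ≃o ℝ := hmono.orderIsoOfSurjective T hsurj with he
  have heT : ∀ x, e x = T x := fun x => rfl
  have hTs : ContDiff ℝ (⊤ : ℕ∞) T := by
    refine contDiff_infty_iff_deriv.2 ⟨fun x => (hderiv x).differentiableAt, ?_⟩
    rw [show deriv T = fun x => 1 / g x from funext fun x => (hderiv x).deriv]
    exact hinv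
  have hθT : ∀ x, e.symm (T x) = x := fun x => e.symm_apply_apply x
  have hTθ : ∀ s, T (e.symm s) = s := fun s => e.apply_symm_apply s
  refine ⟨T, e.symm, ?_, hderiv, by simp [hT], hmono, hθT, hTθ, fun s => ?_, fun x => ?_⟩
  · exact e.toHomeomorph.contDiff_symm_deriv (f' := fun x => 1 / g x)
      (fun x => (hpos' x).ne') hderiv hTs
  · have h := HasDerivAt.of_local_left_inverse (f := T) (g := e.symm) (a := s)
      e.symm.continuous.continuousAt (hderiv _) (hpos' _).ne' (Eventually.of_forall hTθ)
    simpa using h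
  · have h1 := intervalIntegral.integral_add_adjacent_intervals (hint 0 P) (hint P (x + P))
    have h2 := hper'.intervalIntegral_add_eq P 0
    have h3 : ∫ u in P..(x + P), 1 / g u = ∫ u in (0 : ℝ)..x, 1 / g u := by
      have := intervalIntegral.integral_comp_add_right (a := 0) (b := x) (fun u => 1 / g u) P
      rw [zero_add] at this
      rw [← this]
      exact intervalIntegral.integral_congr fun u _ => hper' u
    simp only [hT]
    rw [← h1, h3, add_comm]

/-! ### The Euler–Lagrange equation as an oscillator for √κ -/

theorem rpow_three_halves_sub_one (x : ℝ) : x ^ ((3 / 2 : ℝ) - 1) = √x := by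
  rw [Real.sqrt_eq_rpow]; norm_num

theorem rpow_three_halves_add_one {x : ℝ} (hx : 0 ≤ x) : x ^ ((3 / 2 : ℝ) + 1) = √x ^ 5 := by
  rw [Real.sqrt_eq_rpow, ← Real.rpow_natCast, ← Real.rpow_mul hx]; norm_num

theorem rpow_two_mul_three_halves_sub_two (x : ℝ) :
    x ^ (2 * ((3 / 2 : ℝ) - 2)) = x⁻¹ := by
  rw [← Real.rpow_neg_one]; norm_num

theorem rpow_two_mul_three_halves (x : ℝ) : x ^ (2 * (3 / 2 : ℝ)) = x ^ 3 := by
  rw [← Real.rpow_natCast]; norm_num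

theorem rpow_two_mul_three_halves_sub_one (x : ℝ) : x ^ (2 * ((3 / 2 : ℝ) - 1)) = x := by
  norm_num

theorem rpow_three_halves {x : ℝ} (hx : 0 ≤ x) : x ^ (3 / 2 : ℝ) = √x ^ 3 := by
  rw [Real.sqrt_eq_rpow, ← Real.rpow_natCast, ← Real.rpow_mul hx]; norm_num

/-- The square root of the curvature of a `3/2`-elastic curve solves a quintic oscillator
equation. -/
theorem IsPElasticCurvature.exists_oscillator {a : ℝ} {κ : ℝ → ℝ}
    (h : IsPElasticCurvature (3 / 2) a κ) :
    ∃ v : ℝ → ℝ, (∀ s, HasDerivAt (fun t => √(κ t)) (v s) s) ∧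
      (∀ s, HasDerivAt v (√(κ s) - √(κ s) ^ 5 / 3) s) ∧
      ∀ s, 9 * v s ^ 2 = -√(κ s) ^ 6 + 9 * √(κ s) ^ 2 + 4 * a := by
  have hw : ContDiff ℝ (⊤ : ℕ∞) fun t => √(κ t) := h.smooth.sqrt fun s => (h.convex s).ne'
  have hw1 := contDiff_infty_iff_deriv.1 hw
  have hw2 := contDiff_infty_iff_deriv.1 hw1.2
  refine ⟨deriv fun t => √(κ t), fun s => (hw1.1 s).hasDerivAt, fun s => ?_, fun s => ?_⟩
  · have h1 := h.eulerLagrange s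
    simp only [rpow_three_halves_sub_one, rpow_three_halves_add_one (h.convex s).le,
      iteratedDeriv_succ, iteratedDeriv_zero] at h1
    have h2 := (hw2.1 s).hasDerivAt
    have h3 : √(κ s) - √(κ s) ^ 5 / 3 = deriv (deriv fun t => √(κ t)) s := by
      linear_combination -(2 / 3) * h1
    rwa [h3]
  · have h1 := h.firstIntegral s
    rw [rpow_two_mul_three_halves_sub_two, rpow_two_mul_three_halves,
      rpow_two_mul_three_halves_sub_one] at h1
    have hd : deriv κ s = 2 * √(κ s) * deriv (fun t => √(κ t)) s := by
      have h2 := ((hw1.1 s).hasDerivAt.pow 2).deriv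
      have h3 : ((fun t => √(κ t)) ^ 2 : ℝ → ℝ) = κ := by
        funext t
        simp [Real.sq_sqrt (h.convex t).le]
      rw [h3] at h2
      rw [h2]; norm_num
    have hsq := Real.sq_sqrt (h.convex s).le
    have hp := Real.sqrt_pos.2 (h.convex s)
    rw [hd] at h1
    generalize deriv (fun t => √(κ t)) s = v at *
    generalize √(κ s) = w at *
    rw [← hsq] at h1
    field_simp at h1
    linarith

/-- A positive solution of the quintic oscillator equation gives a solution of the
Euler-Lagrange equation and of its first integral. -/
theorem oscillator_eulerLagrange {a : ℝ} {κ w v : ℝ → ℝ} (hκ : ∀ s, 0 < κ s)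
    (hw : ∀ s, w s = √(κ s)) (h1 : ∀ s, HasDerivAt w (v s) s)
    (h2 : ∀ s, HasDerivAt v (w s - w s ^ 5 / 3) s)
    (h3 : ∀ s, 9 * v s ^ 2 = -w s ^ 6 + 9 * w s ^ 2 + 4 * a) (s : ℝ) :
    ((3 / 2 : ℝ) * iteratedDeriv 2 (fun t => κ t ^ ((3 / 2 : ℝ) - 1)) s
        + ((3 / 2 : ℝ) - 1) * κ s ^ ((3 / 2 : ℝ) + 1)
        - (3 / 2 : ℝ) * κ s ^ ((3 / 2 : ℝ) - 1) = 0) ∧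
      ((3 / 2 : ℝ) ^ 2 * ((3 / 2 : ℝ) - 1) ^ 2 * κ s ^ (2 * ((3 / 2 : ℝ) - 2)) * deriv κ s ^ 2
        + ((3 / 2 : ℝ) - 1) ^ 2 * κ s ^ (2 * (3 / 2 : ℝ))
        - (3 / 2 : ℝ) ^ 2 * κ s ^ (2 * ((3 / 2 : ℝ) - 1)) = a) := by
  constructor
  · simp only [rpow_three_halves_sub_one, rpow_three_halves_add_one (hκ s).le,
      iteratedDeriv_succ, iteratedDeriv_zero, ← hw]
    rw [show deriv (fun t => w t) = v from funext fun t => (h1 t).deriv, (h2 s).deriv]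
    ring
  · rw [rpow_two_mul_three_halves_sub_two, rpow_two_mul_three_halves,
      rpow_two_mul_three_halves_sub_one]
    have hsq : κ = fun t => w t ^ 2 := funext fun t => by rw [hw, Real.sq_sqrt (hκ t).le]
    have hd : deriv κ s = 2 * w s * v s := by
      have h4 : HasDerivAt (fun t => w t ^ 2) _ s := (h1 s).pow 2
      rw [hsq, h4.deriv]
      norm_num
    have hp : 0 < w s := by rw [hw]; exact Real.sqrt_pos.2 (hκ s)
    rw [hd, hsq]
    have := h3 s
    field_simp
    linarith

/-- The quintic oscillator is uniquely solvable among bounded solutions. -/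
theorem oscillator_unique {R : ℝ} {w₁ v₁ w₂ v₂ : ℝ → ℝ} (hw₁ : ∀ s, w₁ s ∈ Icc 0 R)
    (hw₂ : ∀ s, w₂ s ∈ Icc 0 R) (h₁ : ∀ s, HasDerivAt w₁ (v₁ s) s)
    (h₁' : ∀ s, HasDerivAt v₁ (w₁ s - w₁ s ^ 5 / 3) s) (h₂ : ∀ s, HasDerivAt w₂ (v₂ s) s)
    (h₂' : ∀ s, HasDerivAt v₂ (w₂ s - w₂ s ^ 5 / 3) s) (hw : w₁ 0 = w₂ 0) (hv : v₁ 0 = v₂ 0) :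
    w₁ = w₂ := by
  have hf : ContDiff ℝ 1 fun x : ℝ => x - x ^ 5 / 3 := by fun_prop
  obtain ⟨K, hK⟩ := hf.contDiffOn.exists_lipschitzOnWith (one_ne_zero) (convex_Icc 0 R)
    isCompact_Icc
  -- The quintic term is not globally Lipschitz; confining the first component to a compact interval
  -- suffices, and the second enters linearly.
  have hL : LipschitzOnWith (max 1 K) (fun z : ℝ × ℝ => (z.2, z.1 - z.1 ^ 5 / 3))
      (Icc 0 R ×ˢ univ) := by
    refine LipschitzOnWith.prodMk (LipschitzWith.prod_snd.lipschitzOnWith) ?_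
    have := hK.comp (LipschitzWith.prod_fst (α := ℝ) (β := ℝ)).lipschitzOnWith
      (s := Icc 0 R ×ˢ univ) (fun z hz => hz.1)
    simpa [Function.comp_def] using this
  have key := ODE_solution_unique_univ (v := fun _ (z : ℝ × ℝ) => (z.2, z.1 - z.1 ^ 5 / 3))
    (s := fun _ => Icc 0 R ×ˢ univ) (f := fun s => (w₁ s, v₁ s)) (g := fun s => (w₂ s, v₂ s))
    (t₀ := 0) (fun _ => hL) (fun s => ⟨(h₁ s).prodMk (h₁' s), hw₁ s, mem_univ _⟩)
    (fun s => ⟨(h₂ s).prodMk (h₂' s), hw₂ s, mem_univ _⟩) (by simp [hw, hv])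
  funext s
  exact congrArg Prod.fst (congrFun key s)

/-! ### Existence of a curve: phase angle, least period, angular progression -/

/-- The curvature in terms of the phase angle. -/
def elasticProfile (α β θ : ℝ) : ℝ := α - (α - β) * Real.sin θ ^ 2

/-- The closure function in terms of the phase angle. -/
def closureIntegral (α β : ℝ) : ℝ :=
  6 * √(α * β * (α + β)) * ∫ θ in (0 : ℝ)..(Real.pi / 2),
    elasticProfile α β θ / ((9 * elasticProfile α β θ - α * β * (α + β))
      * √(elasticProfile α β θ + α + β))

section

variable {α β : ℝ}

theorem elasticProfile_mem_Icc (hαβ : β < α) (θ : ℝ) : elasticProfile α β θ ∈ Icc β α := by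
  have h1 := Real.sin_sq_le_one θ
  have h2 := sq_nonneg (Real.sin θ)
  unfold elasticProfile
  constructor <;> nlinarith

theorem elasticProfile_pos (hβ : 0 < β) (hαβ : β < α) (θ : ℝ) : 0 < elasticProfile α β θ :=
  hβ.trans_le (elasticProfile_mem_Icc hαβ θ).1

theorem elasticProfile_add_pos (hβ : 0 < β) (hαβ : β < α) (θ : ℝ) :
    0 < elasticProfile α β θ + α + β := by
  have := elasticProfile_pos hβ hαβ θ
  linarith

theorem elasticProfile_periodic : Function.Periodic (elasticProfile α β) Real.pi := fun θ => by
  simp [elasticProfile, Real.sin_add_pi]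

theorem contDiff_elasticProfile {n : ℕ∞} : ContDiff ℝ n (elasticProfile α β) := by
  unfold elasticProfile
  fun_prop

theorem continuous_elasticProfile : Continuous (elasticProfile α β) :=
  (contDiff_elasticProfile (n := 0)).continuous

theorem hasDerivAt_elasticProfile (θ : ℝ) :
    HasDerivAt (elasticProfile α β) (-(2 * (α - β) * Real.sin θ * Real.cos θ)) θ := by
  have h : HasDerivAt (elasticProfile α β) _ θ :=
    (((Real.hasDerivAt_sin θ).pow 2).const_mul (α - β)).const_sub α
  convert h using 1
  norm_num
  ring

/-- The curvature satisfies `9κ - c > 0`, where `c = αβ(α + β)`. -/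
theorem elasticProfile_denom_pos (hβ : 0 < β) (hαβ : β < α) (h9 : α ^ 2 + α * β + β ^ 2 = 9)
    (θ : ℝ) : 0 < 9 * elasticProfile α β θ - α * β * (α + β) := by
  have h1 := (elasticProfile_mem_Icc hαβ θ).1
  have h2 : 9 * β - α * β * (α + β) = β ^ 3 := by rw [← h9]; ring
  have h3 : 0 < β ^ 3 := by positivity
  linarith

/-- The square root of `-κ³ + 9κ - c` is a smooth function of the phase angle, up to sign. -/
theorem rootFactor_sq (hβ : 0 < β) (hαβ : β < α) (h9 : α ^ 2 + α * β + β ^ 2 = 9) (θ : ℝ) :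
    ((α - β) * Real.sin θ * Real.cos θ * √(elasticProfile α β θ + α + β)) ^ 2
      = -elasticProfile α β θ ^ 3 + 9 * elasticProfile α β θ - α * β * (α + β) := by
  -- With k the profile, α − k = (α−β) sin²θ and k − β = (α−β) cos²θ, so the square is
  -- (α−k)(k−β)(k+α+β), the factored cubic.
  rw [mul_pow, mul_pow, mul_pow, Real.sq_sqrt (elasticProfile_add_pos hβ hαβ θ).le, Real.cos_sq',
    elasticProfile]
  linear_combination (α - (α - β) * Real.sin θ ^ 2) * h9

/-- Differentiating F² = −k³ + 9k − c, with k' = −2F/√(k+α+β), suggests the value after cancelling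
F. As F has zeros, the proof uses the product rule instead. Along the flow this becomes the equation
for w''. -/
theorem hasDerivAt_rootFactor (hβ : 0 < β) (hαβ : β < α) (h9 : α ^ 2 + α * β + β ^ 2 = 9) (θ : ℝ) :
    HasDerivAt (fun θ => (α - β) * Real.sin θ * Real.cos θ * √(elasticProfile α β θ + α + β))
      (-(9 - 3 * elasticProfile α β θ ^ 2) / √(elasticProfile α β θ + α + β)) θ := by
  have kpos' := elasticProfile_add_pos hβ hαβ θ
  have h1 := (((hasDerivAt_elasticProfile (α := α) (β := β) θ).add_const α).add_const β).sqrt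
    kpos'.ne'
  have h2 := (((Real.hasDerivAt_sin θ).const_mul (α - β)).mul (Real.hasDerivAt_cos θ)).mul h1
  refine h2.congr_deriv ?_
  have p2 := (Real.sqrt_pos.2 kpos').ne'
  have q2 := Real.sq_sqrt kpos'.le
  simp only [Pi.mul_apply]
  generalize √(elasticProfile α β θ + α + β) = Z at *
  have e : -((α - β) * (1 - 2 * Real.sin θ ^ 2) * Z ^ 2
      - (α - β) ^ 2 * Real.sin θ ^ 2 * (1 - Real.sin θ ^ 2)) = 9 - 3 * elasticProfile α β θ ^ 2 := by
    rw [q2, elasticProfile]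
    linear_combination h9
  rw [← e]
  field_simp
  rw [Real.cos_sq']
  ring

/-- A `3/2`-elastic curve for given roots, with its least period and angular progression. -/
theorem exists_elasticCurve (hβ : 0 < β) (hαβ : β < α) (h9 : α ^ 2 + α * β + β ^ 2 = 9) :
    ∃ (κ : ℝ → ℝ) (ρ : ℝ), IsPElasticCurvature (3 / 2) (-(α * β * (α + β)) / 4) κ ∧
      IsLeastPeriod κ ρ ∧ κ 0 = α ∧
      angularProgression (3 / 2) (-(α * β * (α + β)) / 4) κ ρ = closureIntegral α β := by
  set k := elasticProfile α β with hk
  have kpos := elasticProfile_pos hβ hαβ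
  have kpos' := elasticProfile_add_pos hβ hαβ
  rw [← hk] at kpos kpos'
  have hα : 0 < α := hβ.trans hαβ
  -- This speed is forced by 9w'² = P(κ): the factor sin θ cos θ cancels, leaving a positive
  -- function, so turning points of κ are crossed smoothly.
  have hg : ContDiff ℝ (⊤ : ℕ∞) fun x => √(k x) * √(k x + α + β) / 3 :=
    ((contDiff_elasticProfile.sqrt fun x => (kpos x).ne').mul
      (((contDiff_elasticProfile.add contDiff_const).add contDiff_const).sqrt
        fun x => (kpos' x).ne')).div_const 3
  have gpos : ∀ x, 0 < √(k x) * √(k x + α + β) / 3 := fun x => by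
    have := Real.sqrt_pos.2 (kpos x)
    have := Real.sqrt_pos.2 (kpos' x)
    positivity
  have kper : Function.Periodic k Real.pi := elasticProfile_periodic
  obtain ⟨T, θ, θs, Td, T0, Tm, θT, Tθ, θd, Tp⟩ := exists_smooth_flow_of_periodic hg gpos
    (P := Real.pi) (fun x => by simp only [kper x]) Real.pi_pos
  have θ0 : θ 0 = 0 := by simpa [T0] using θT 0
  have θadd : ∀ s, θ (s + T Real.pi) = θ s + Real.pi := fun s => by
    rw [← θT (θ s + Real.pi), Tp, Tθ]
  have Tπ : 0 < T Real.pi := by rw [← T0]; exact Tm Real.pi_pos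
  have hper : Function.Periodic (fun s => k (θ s)) (T Real.pi) := fun s => by
    simp only [θadd, kper _]
  refine ⟨fun s => k (θ s), T Real.pi, ?_, ⟨⟨Tπ, hper⟩, ?_⟩, ?_, ?_⟩
  · have hw : ∀ s, HasDerivAt (fun s => √(k (θ s)))
        (-((α - β) * Real.sin (θ s) * Real.cos (θ s) * √(k (θ s) + α + β)) / 3) s := by
      intro s
      have h1 := (((hasDerivAt_elasticProfile (α := α) (β := β) (θ s)).comp s (θd s))).sqrt
        (kpos (θ s)).ne'
      refine h1.congr_deriv ?_
      have := (Real.sqrt_pos.2 (kpos (θ s))).ne'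
      simp only [Function.comp_apply, ← hk]
      field_simp
    have hv : ∀ s, HasDerivAt (fun s => -((α - β) * Real.sin (θ s) * Real.cos (θ s)
        * √(k (θ s) + α + β)) / 3) (√(k (θ s)) - √(k (θ s)) ^ 5 / 3) s := by
      intro s
      refine ((hasDerivAt_rootFactor hβ hαβ h9 (θ s)).neg.div_const 3).comp s (θd s) |>.congr_deriv ?_
      simp only [← hk]
      have p2 := (Real.sqrt_pos.2 (kpos' (θ s))).ne'
      have q5 : √(k (θ s)) ^ 5 = √(k (θ s)) * k (θ s) ^ 2 := by
        calc √(k (θ s)) ^ 5 = √(k (θ s)) * (√(k (θ s)) ^ 2) ^ 2 := by ring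
          _ = _ := by rw [Real.sq_sqrt (kpos (θ s)).le]
      rw [q5]
      field_simp
      ring
    have hE := oscillator_eulerLagrange (a := -(α * β * (α + β)) / 4) (fun s => kpos (θ s))
      (fun _ => rfl) hw hv ?_
    · refine ⟨?_, fun s => kpos _, ⟨0, T (Real.pi / 2), ?_⟩, ⟨_, Tπ, hper⟩, fun s => (hE s).1,
        fun s => (hE s).2⟩
      · exact contDiff_elasticProfile.comp θs
      · simp only [θ0, θT, hk, elasticProfile, Real.sin_zero, Real.sin_pi_div_two]
        intro h
        linarith
    · intro s
      have q1 := Real.sq_sqrt (kpos (θ s)).le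
      have q5 : √(k (θ s)) ^ 6 = k (θ s) ^ 3 := by
        calc √(k (θ s)) ^ 6 = (√(k (θ s)) ^ 2) ^ 3 := by ring
          _ = _ := by rw [q1]
      rw [q5, q1]
      linear_combination rootFactor_sq hβ hαβ h9 (θ s)
  -- A period S returns κ to its maximum, so θ(S) is a multiple nπ; S > 0 forces n ≥ 1.
  · rintro S ⟨hS, hSp⟩
    have h1 : k (θ S) = k 0 := by
      have := hSp 0
      simpa [θ0] using this
    have h2 : Real.sin (θ S) = 0 := by
      simp only [hk, elasticProfile, Real.sin_zero] at h1
      have : (α - β) * Real.sin (θ S) ^ 2 = 0 := by linarith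
      simpa [(sub_pos.2 hαβ).ne'] using this
    obtain ⟨n, hn⟩ := Real.sin_eq_zero_iff.1 h2
    have h3 : 0 < θ S := by
      rw [← Tm.lt_iff_lt, T0, Tθ]; exact hS
    have h4 : (1 : ℝ) ≤ n := by
      have : (0 : ℝ) < n := by
        rw [← hn] at h3
        exact pos_of_mul_pos_left h3 Real.pi_pos.le
      exact_mod_cast this
    rw [← Tθ S]
    refine Tm.monotone ?_
    rw [← hn]
    nlinarith [Real.pi_pos]
  · simp [θ0, hk, elasticProfile]
  · unfold angularProgression closureIntegral
    rw [← hk]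
    set c := α * β * (α + β) with hc
    have hc0 : 0 < c := by positivity
    set h : ℝ → ℝ := fun x => x ^ (3 / 2 : ℝ) / (-c / 4 + (3 / 2 : ℝ) ^ 2 * x ^ (2 * ((3 / 2 : ℝ) - 1)))
      with hh
    have e1 : ∫ s in (0 : ℝ)..T Real.pi, h (k (θ s))
        = ∫ x in (0 : ℝ)..Real.pi, h (k x) * (1 / (√(k x) * √(k x + α + β) / 3)) := by
      have := intervalIntegral.integral_comp_mul_deriv_of_deriv_nonneg (a := 0) (b := Real.pi)
        (f := T) (g := fun s => h (k (θ s)))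
        (fun x _ => (Td x).continuousAt.continuousWithinAt) (fun x _ => Td x)
        (fun x _ => (one_div_pos.2 (gpos x)).le)
      rw [T0] at this
      rw [← this]
      simp only [Function.comp, θT]
    have e2 : ∀ x, h (k x) * (1 / (√(k x) * √(k x + α + β) / 3))
        = 12 * (k x / ((9 * k x - c) * √(k x + α + β))) := by
      intro x
      have p1 := (Real.sqrt_pos.2 (kpos x)).ne'
      have p2 := (Real.sqrt_pos.2 (kpos' x)).ne'
      have p3 : 9 * k x - c ≠ 0 := (elasticProfile_denom_pos hβ hαβ h9 x).ne'
      have q1 := Real.sq_sqrt (kpos x).le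
      simp only [hh]
      rw [rpow_three_halves (kpos x).le, rpow_two_mul_three_halves_sub_one]
      have p4 : -c / 4 + (3 / 2) ^ 2 * k x = (9 * k x - c) / 4 := by ring
      rw [p4, pow_succ, q1]
      field_simp
      ring
    have e3 : √(-(-c / 4)) = √c / 2 := by
      rw [show -(-c / 4) = c / 2 ^ 2 by ring, Real.sqrt_div' _ (by positivity),
        Real.sqrt_sq (by norm_num)]
    set f : ℝ → ℝ := fun x => k x / ((9 * k x - c) * √(k x + α + β)) with hf
    have fc : Continuous f := by
      refine continuous_elasticProfile.div ?_ fun x =>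
        (mul_pos (elasticProfile_denom_pos hβ hαβ h9 x) (Real.sqrt_pos.2 (kpos' x))).ne'
      have := continuous_elasticProfile (α := α) (β := β)
      fun_prop
    -- The profile is symmetric about θ = π/2.
    have e4 : ∫ x in (0 : ℝ)..Real.pi, f x = 2 * ∫ x in (0 : ℝ)..(Real.pi / 2), f x := by
      rw [← intervalIntegral.integral_add_adjacent_intervals (fc.intervalIntegrable 0 (Real.pi / 2))
        (fc.intervalIntegrable _ _)]
      have := intervalIntegral.integral_comp_sub_left (a := 0) (b := Real.pi / 2) f Real.pi
      rw [sub_zero, sub_half] at this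
      rw [← this, two_mul]
      congr 1
      refine intervalIntegral.integral_congr fun x _ => ?_
      simp only [hf, hk, elasticProfile, Real.sin_pi_sub]
    rw [e1]
    simp only [e2]
    rw [intervalIntegral.integral_const_mul, e4, e3]
    ring

end

/-! ### Uniqueness up to translation; the closure function is well defined -/

section

variable {α β : ℝ}

/-- The positive values at which `-x³ + 9x - αβ(α+β)` is nonnegative. -/
theorem mem_Icc_of_cubic_nonneg (hβ : 0 < β) (hαβ : β < α) (h9 : α ^ 2 + α * β + β ^ 2 = 9)
    {x : ℝ} (hx : 0 < x) (h : 0 ≤ -x ^ 3 + 9 * x - α * β * (α + β)) : x ∈ Icc β α := by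
  have h1 : -x ^ 3 + 9 * x - α * β * (α + β) = (α - x) * (x - β) * (x + α + β) := by
    linear_combination -x * h9
  rw [h1] at h
  have h2 : 0 ≤ (α - x) * (x - β) := nonneg_of_mul_nonneg_left h (by linarith)
  constructor <;> by_contra! h3 <;> nlinarith

theorem eq_or_eq_of_cubic_eq_zero (hβ : 0 < β) (hαβ : β < α) (h9 : α ^ 2 + α * β + β ^ 2 = 9)
    {x : ℝ} (hx : 0 < x) (h : -x ^ 3 + 9 * x - α * β * (α + β) = 0) : x = α ∨ x = β := by
  have h1 : (α - x) * (x - β) * (x + α + β) = 0 := by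
    linear_combination h + x * h9
  rcases mul_eq_zero.1 h1 with h2 | h2
  · rcases mul_eq_zero.1 h2 with h3 | h3
    · left; linarith
    · right; linarith
  · linarith

/-- All `3/2`-elastic curves with the same constant of integration are translates of each other. -/
theorem IsPElasticCurvature.exists_translate (hβ : 0 < β) (hαβ : β < α)
    (h9 : α ^ 2 + α * β + β ^ 2 = 9) {κ κ₀ : ℝ → ℝ}
    (h : IsPElasticCurvature (3 / 2) (-(α * β * (α + β)) / 4) κ)
    (h₀ : IsPElasticCurvature (3 / 2) (-(α * β * (α + β)) / 4) κ₀) (h₀0 : κ₀ 0 = α) :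
    ∃ s₀, ∀ s, κ (s + s₀) = κ₀ s := by
  have six : ∀ {x : ℝ}, 0 < x → √x ^ 6 = x ^ 3 := fun {x} hx => by
    calc √x ^ 6 = (√x ^ 2) ^ 3 := by ring
      _ = _ := by rw [Real.sq_sqrt hx.le]
  have key : ∀ {μ : ℝ → ℝ}, IsPElasticCurvature (3 / 2) (-(α * β * (α + β)) / 4) μ →
      ∀ s, μ s ∈ Icc β α := by
    intro μ hμ s
    obtain ⟨v, -, -, hv⟩ := hμ.exists_oscillator
    refine mem_Icc_of_cubic_nonneg hβ hαβ h9 (hμ.convex s) ?_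
    have h1 := hv s
    rw [six (hμ.convex s), Real.sq_sqrt (hμ.convex s).le] at h1
    nlinarith [sq_nonneg (v s)]
  -- At a maximum point w' vanishes, so κ there is a root of the cubic. The root β is excluded: κ ≥
  -- β everywhere would then make κ constant.
  obtain ⟨s₀, hs₀⟩ : ∃ s₀, ∀ s, κ s ≤ κ s₀ := by
    obtain ⟨T, hT, hp⟩ := h.periodic
    obtain ⟨s₀, -, hs₀⟩ := isCompact_Icc.exists_isMaxOn (nonempty_Icc.2 hT.le)
      h.smooth.continuous.continuousOn
    refine ⟨s₀, fun s => ?_⟩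
    obtain ⟨y, hy, hys⟩ := hp.exists_mem_Ico₀ hT s
    rw [hys]
    exact hs₀ (Ico_subset_Icc_self hy)
  obtain ⟨v, hv1, hv2, hv3⟩ := h.exists_oscillator
  obtain ⟨v₀, hv1₀, hv2₀, hv3₀⟩ := h₀.exists_oscillator
  have vs₀ : v s₀ = 0 := by
    have hmax : IsLocalMax (fun t => √(κ t)) s₀ :=
      Eventually.of_forall fun s => Real.sqrt_le_sqrt (hs₀ s)
    exact hmax.hasDerivAt_eq_zero (hv1 s₀)
  have κs₀ : κ s₀ = α := by
    have h1 := hv3 s₀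
    rw [vs₀, six (h.convex s₀), Real.sq_sqrt (h.convex s₀).le] at h1
    refine (eq_or_eq_of_cubic_eq_zero hβ hαβ h9 (h.convex s₀) (by linarith)).resolve_right ?_
    intro h2
    obtain ⟨s, t, hst⟩ := h.nonconstant
    have h3 : ∀ s, κ s = β := fun s => le_antisymm (h2 ▸ hs₀ s) (key h s).1
    exact hst ((h3 s).trans (h3 t).symm)
  have v₀0 : v₀ 0 = 0 := by
    have h1 := hv3₀ 0
    rw [six (h₀.convex 0), Real.sq_sqrt (h₀.convex 0).le, h₀0] at h1
    have : v₀ 0 ^ 2 = 0 := by linear_combination h1 / 9 - α / 9 * h9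
    simpa using this
  have hu := oscillator_unique (R := √α) (w₁ := fun s => √(κ (s + s₀))) (v₁ := fun s => v (s + s₀))
    (w₂ := fun s => √(κ₀ s)) (v₂ := v₀)
    (fun s => ⟨Real.sqrt_nonneg _, Real.sqrt_le_sqrt (key h _).2⟩)
    (fun s => ⟨Real.sqrt_nonneg _, Real.sqrt_le_sqrt (key h₀ _).2⟩)
    (fun s => (hv1 (s + s₀)).comp_add_const s s₀) (fun s => (hv2 (s + s₀)).comp_add_const s s₀)
    hv1₀ hv2₀ (by simp [κs₀, h₀0]) (by simp [vs₀, v₀0])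
  refine ⟨s₀, fun s => ?_⟩
  have h1 := congrFun hu s
  exact (Real.sqrt_inj (h.convex _).le (h₀.convex _).le).1 h1

theorem IsLeastPeriod.of_translate {κ κ₀ : ℝ → ℝ} {s₀ ρ : ℝ} (h : ∀ s, κ (s + s₀) = κ₀ s)
    (hρ : IsLeastPeriod κ₀ ρ) : IsLeastPeriod κ ρ := by
  have e : {T : ℝ | 0 < T ∧ Function.Periodic κ T} = {T : ℝ | 0 < T ∧ Function.Periodic κ₀ T} := by
    ext T
    refine and_congr_right fun _ => ⟨fun hp s => ?_, fun hp s => ?_⟩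
    · rw [← h, ← h, ← hp (s + s₀)]; ring_nf
    · have := hp (s - s₀)
      rw [← h, ← h] at this
      rw [sub_add_cancel] at this
      rw [← this]; ring_nf
  unfold IsLeastPeriod
  rw [e]
  exact hρ

/-- Translation only shifts the window of integration, and over a full period the integral does not
depend on the window. -/
theorem angularProgression_of_translate {p a : ℝ} {κ κ₀ : ℝ → ℝ} {s₀ ρ : ℝ}
    (h : ∀ s, κ (s + s₀) = κ₀ s) (hρ : Function.Periodic κ₀ ρ) :
    angularProgression p a κ ρ = angularProgression p a κ₀ ρ := by
  have h' : ∀ s, κ s = κ₀ (s - s₀) := fun s => by rw [← h, sub_add_cancel]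
  unfold angularProgression
  congr 1
  simp only [h']
  rw [intervalIntegral.integral_comp_sub_right
    (fun s => κ₀ s ^ p / (a + p ^ 2 * κ₀ s ^ (2 * (p - 1)))) s₀]
  have hp : Function.Periodic (fun s => κ₀ s ^ p / (a + p ^ 2 * κ₀ s ^ (2 * (p - 1)))) ρ :=
    fun s => by simp only [hρ s]
  have := hp.intervalIntegral_add_eq (0 - s₀) 0
  rw [zero_add] at this
  rw [← this]
  ring_nf

/-- The closure function is well defined, with value given by an integral over the phase angle. -/
theorem closureFunction_wellDefined (hβ : 0 < β) (hαβ : β < α) (h9 : α ^ 2 + α * β + β ^ 2 = 9) :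
    (∃ κ : ℝ → ℝ, IsPElasticCurvature (3 / 2) (-(α * β * (α + β)) / 4) κ) ∧
      (∀ κ : ℝ → ℝ, IsPElasticCurvature (3 / 2) (-(α * β * (α + β)) / 4) κ →
        ∃ ϱ, IsLeastPeriod κ ϱ ∧ closureFunction (3 / 2) (-(α * β * (α + β)) / 4)
          = angularProgression (3 / 2) (-(α * β * (α + β)) / 4) κ ϱ) ∧
      closureFunction (3 / 2) (-(α * β * (α + β)) / 4) = closureIntegral α β := by
  obtain ⟨κ₀, ρ, h₀, hρ, h₀0, hΛ⟩ := exists_elasticCurve hβ hαβ h9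
  have key : ∀ κ : ℝ → ℝ, IsPElasticCurvature (3 / 2) (-(α * β * (α + β)) / 4) κ →
      IsLeastPeriod κ ρ ∧
        angularProgression (3 / 2) (-(α * β * (α + β)) / 4) κ ρ = closureIntegral α β := by
    intro κ hκ
    obtain ⟨s₀, hs₀⟩ := hκ.exists_translate hβ hαβ h9 h₀ h₀0
    exact ⟨hρ.of_translate hs₀, (angularProgression_of_translate hs₀ hρ.1.2).trans hΛ⟩
  have hval : closureFunction (3 / 2) (-(α * β * (α + β)) / 4) = closureIntegral α β := by
    have hex : ∃ L, IsClosureValue (3 / 2) (-(α * β * (α + β)) / 4) L :=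
      ⟨_, κ₀, ρ, h₀, hρ, rfl⟩
    unfold closureFunction
    rw [dif_pos hex]
    -- Whichever curve the choice picks, its least period and progression are those of the model
    -- curve.
    obtain ⟨κ, ϱ, hκ, hϱ, hL⟩ := hex.choose_spec
    rw [hL, IsLeast.unique hϱ (key κ hκ).1]
    exact (key κ hκ).2
  exact ⟨⟨κ₀, h₀⟩, fun κ hκ => ⟨ρ, (key κ hκ).1, hval.trans (key κ hκ).2.symm⟩, hval⟩

end

/-! ### Complete elliptic integrals and Heuman's Lambda function -/

section

variable {m : ℝ}

theorem one_sub_mul_sin_sq_pos (hm : m < 1) (θ : ℝ) : 0 < 1 - m * Real.sin θ ^ 2 := by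
  have h1 := Real.sin_sq_le_one θ
  have h2 := sq_nonneg (Real.sin θ)
  rcases le_total m 0 with h | h <;> nlinarith

theorem continuous_sqrt_one_sub_mul_sin_sq : Continuous fun θ : ℝ => √(1 - m * Real.sin θ ^ 2) := by
  fun_prop

theorem continuous_one_div_sqrt_one_sub_mul_sin_sq (hm : m < 1) :
    Continuous fun θ : ℝ => 1 / √(1 - m * Real.sin θ ^ 2) :=
  continuous_const.div continuous_sqrt_one_sub_mul_sin_sq fun θ =>
    (Real.sqrt_pos.2 (one_sub_mul_sin_sq_pos hm θ)).ne'

theorem hasDerivAt_sqrt_one_sub_mul_sin_sq (hm : m < 1) (θ : ℝ) :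
    HasDerivAt (fun θ : ℝ => √(1 - m * Real.sin θ ^ 2))
      (-(m * Real.sin θ * Real.cos θ / √(1 - m * Real.sin θ ^ 2))) θ := by
  have h := ((((Real.hasDerivAt_sin θ).pow 2).const_mul m).const_sub 1).sqrt
    (one_sub_mul_sin_sq_pos hm θ).ne'
  refine h.congr_deriv ?_
  have := (Real.sqrt_pos.2 (one_sub_mul_sin_sq_pos hm θ)).ne'
  simp only [Pi.pow_apply]
  field_simp
  norm_num
  ring

/-- The derivative of `sin cos Δ / (n - m sin²)`, where `Δ = √(1 - m sin²)`. -/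
theorem hasDerivAt_sin_mul_cos_mul_sqrt_div (hm : m < 1) {n θ : ℝ} (hn : 0 < n - m * Real.sin θ ^ 2) :
    HasDerivAt (fun θ : ℝ => Real.sin θ * Real.cos θ * √(1 - m * Real.sin θ ^ 2)
        / (n - m * Real.sin θ ^ 2))
      ((((Real.cos θ ^ 2 - Real.sin θ ^ 2) * (1 - m * Real.sin θ ^ 2)
          - m * Real.sin θ ^ 2 * Real.cos θ ^ 2) * (n - m * Real.sin θ ^ 2)
        + 2 * m * Real.sin θ ^ 2 * Real.cos θ ^ 2 * (1 - m * Real.sin θ ^ 2))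
        / (√(1 - m * Real.sin θ ^ 2) * (n - m * Real.sin θ ^ 2) ^ 2)) θ := by
  have h1 := (((Real.hasDerivAt_sin θ).mul (Real.hasDerivAt_cos θ)).mul
    (hasDerivAt_sqrt_one_sub_mul_sin_sq hm θ)).div
      ((((Real.hasDerivAt_sin θ).pow 2).const_mul m).const_sub n) hn.ne'
  refine h1.congr_deriv ?_
  have h2 := (Real.sqrt_pos.2 (one_sub_mul_sin_sq_pos hm θ)).ne'
  have h3 := Real.sq_sqrt (one_sub_mul_sin_sq_pos hm θ).le
  simp only [Pi.pow_apply, Pi.mul_apply]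
  generalize √(1 - m * Real.sin θ ^ 2) = d at *
  rw [← h3]
  have := hn.ne'
  field_simp
  norm_num
  ring

end

/-- The complete elliptic integral of the third kind in the circular case, up to normalization, in
terms of the complete and incomplete elliptic integrals of the first and second kinds. -/
theorem integral_circular_thirdKind {m φ : ℝ} (hm0 : 0 < m) (hm1 : m < 1) (hφ0 : 0 ≤ φ)
    (hφ : φ < Real.pi / 2) :
    ∫ θ in (0 : ℝ)..(Real.pi / 2),
        (1 - m) * Real.sin φ * Real.cos φ * √(1 - (1 - m) * Real.sin φ ^ 2)
          / ((1 - (1 - m) * Real.sin φ ^ 2 - m * Real.sin θ ^ 2) * √(1 - m * Real.sin θ ^ 2))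
      = (∫ θ in (0 : ℝ)..(Real.pi / 2), √(1 - m * Real.sin θ ^ 2))
            * (∫ t in (0 : ℝ)..φ, 1 / √(1 - (1 - m) * Real.sin t ^ 2))
          + (∫ θ in (0 : ℝ)..(Real.pi / 2), 1 / √(1 - m * Real.sin θ ^ 2))
            * (∫ t in (0 : ℝ)..φ, √(1 - (1 - m) * Real.sin t ^ 2))
          - (∫ θ in (0 : ℝ)..(Real.pi / 2), 1 / √(1 - m * Real.sin θ ^ 2))
            * (∫ t in (0 : ℝ)..φ, 1 / √(1 - (1 - m) * Real.sin t ^ 2)) := by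
  have hq1 : 1 - m < 1 := by linarith
  have hpi := Real.pi_pos
  set d : ℝ → ℝ := fun θ => √(1 - m * Real.sin θ ^ 2) with hd
  set D : ℝ → ℝ := fun t => √(1 - (1 - m) * Real.sin t ^ 2) with hD
  have dpos : ∀ θ, 0 < d θ := fun θ => Real.sqrt_pos.2 (one_sub_mul_sin_sq_pos hm1 θ)
  have Dpos : ∀ t, 0 < D t := fun t => Real.sqrt_pos.2 (one_sub_mul_sin_sq_pos hq1 t)
  have dsq : ∀ θ, d θ ^ 2 = 1 - m * Real.sin θ ^ 2 := fun θ =>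
    Real.sq_sqrt (one_sub_mul_sin_sq_pos hm1 θ).le
  have Dsq : ∀ t, D t ^ 2 = 1 - (1 - m) * Real.sin t ^ 2 := fun t =>
    Real.sq_sqrt (one_sub_mul_sin_sq_pos hq1 t).le
  have dc : Continuous d := continuous_sqrt_one_sub_mul_sin_sq
  have Dc : Continuous D := continuous_sqrt_one_sub_mul_sin_sq
  have dc' : Continuous fun θ => 1 / d θ := continuous_one_div_sqrt_one_sub_mul_sin_sq hm1
  have Dc' : Continuous fun t => 1 / D t := continuous_one_div_sqrt_one_sub_mul_sin_sq hq1
  -- The expression equals (1−m) cos²t + m cos²θ; φ < π/2 keeps the rectangle away from its zero at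
  -- t = θ = π/2.
  have Npos : ∀ t ∈ Icc 0 φ, ∀ θ, 0 < 1 - (1 - m) * Real.sin t ^ 2 - m * Real.sin θ ^ 2 := by
    intro t ht θ
    have h1 : 0 < Real.cos t := Real.cos_pos_of_mem_Ioo ⟨by linarith [ht.1], by linarith [ht.2]⟩
    have h2 := Real.sin_sq_le_one θ
    have h3 := Real.sin_sq t
    have h4 : 0 < (1 - m) * Real.cos t ^ 2 := by
      have : 0 < 1 - m := by linarith
      positivity
    nlinarith
  -- the two components of the vector field and their derivatives
  set A : ℝ → ℝ → ℝ := fun t θ => (1 - m) / d θ * ((((Real.cos t ^ 2 - Real.sin t ^ 2)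
      * (1 - (1 - m) * Real.sin t ^ 2) - (1 - m) * Real.sin t ^ 2 * Real.cos t ^ 2)
      * (1 - m * Real.sin θ ^ 2 - (1 - m) * Real.sin t ^ 2)
      + 2 * (1 - m) * Real.sin t ^ 2 * Real.cos t ^ 2 * (1 - (1 - m) * Real.sin t ^ 2))
      / (D t * (1 - m * Real.sin θ ^ 2 - (1 - m) * Real.sin t ^ 2) ^ 2)) with hA
  set B : ℝ → ℝ → ℝ := fun t θ => m / D t * ((((Real.cos θ ^ 2 - Real.sin θ ^ 2)
      * (1 - m * Real.sin θ ^ 2) - m * Real.sin θ ^ 2 * Real.cos θ ^ 2)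
      * (1 - (1 - m) * Real.sin t ^ 2 - m * Real.sin θ ^ 2)
      + 2 * m * Real.sin θ ^ 2 * Real.cos θ ^ 2 * (1 - m * Real.sin θ ^ 2))
      / (d θ * (1 - (1 - m) * Real.sin t ^ 2 - m * Real.sin θ ^ 2) ^ 2)) with hB
  -- The heart of the formula: the divergence of the field separates into products of a function of
  -- t and a function of θ. Integrated over the rectangle, `B` contributes nothing because sin θ cos
  -- θ vanishes at 0 and π/2, while `A` leaves the third-kind integrand on the edge t = φ.
  have hAB : ∀ t ∈ Icc 0 φ, ∀ θ, A t θ + B t θ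
      = d θ * (1 / D t) + 1 / d θ * D t - 1 / d θ * (1 / D t) := by
    intro t ht θ
    have h1 := (Npos t ht θ).ne'
    have h2 : 1 - m * Real.sin θ ^ 2 - (1 - m) * Real.sin t ^ 2 ≠ 0 := by
      rwa [sub_right_comm]
    have h3 := (dpos θ).ne'
    have h4 := (Dpos t).ne'
    simp only [hA, hB]
    rw [Real.cos_sq', Real.cos_sq', sub_right_comm 1 (m * Real.sin θ ^ 2)]
    have h5 := dsq θ
    have h6 := Dsq t
    field_simp
    rw [h5, h6]
    ring
  have hAc : ContinuousOn (Function.uncurry A) (Icc 0 φ ×ˢ Icc 0 (Real.pi / 2)) := by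
    have c1 : Continuous fun z : ℝ × ℝ => d z.2 := dc.comp continuous_snd
    have c2 : Continuous fun z : ℝ × ℝ => D z.1 := Dc.comp continuous_fst
    refine ContinuousOn.mul ?_ ?_
    · exact continuousOn_const.div c1.continuousOn fun z _ => (dpos _).ne'
    · refine ContinuousOn.div ?_ ?_ fun z hz => ?_
      · fun_prop
      · fun_prop
      · have := Npos z.1 hz.1 z.2
        rw [sub_right_comm] at this
        exact (mul_pos (Dpos _) (pow_pos this 2)).ne'
  have hAcθ : ∀ t ∈ Icc 0 φ, ContinuousOn (A t) (Icc 0 (Real.pi / 2)) := fun t ht =>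
    hAc.comp (f := fun θ : ℝ => (t, θ)) (by fun_prop) fun θ hθ => ⟨ht, hθ⟩
  have hAct : ∀ θ ∈ Icc 0 (Real.pi / 2), ContinuousOn (fun t => A t θ) (Icc 0 φ) := fun θ hθ =>
    hAc.comp (f := fun t : ℝ => (t, θ)) (by fun_prop) fun t ht => ⟨ht, hθ⟩
  have hpi2 : (0 : ℝ) ≤ Real.pi / 2 := by positivity
  have hBint : ∀ t ∈ Icc 0 φ, IntervalIntegrable (B t) volume 0 (Real.pi / 2) := by
    intro t ht
    refine Continuous.intervalIntegrable ?_ _ _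
    refine continuous_const.mul (Continuous.div (by fun_prop) (by fun_prop) fun θ => ?_)
    exact (mul_pos (dpos _) (pow_pos (Npos t ht θ) 2)).ne'
  have hB0 : ∀ t ∈ Icc 0 φ, ∫ θ in (0 : ℝ)..(Real.pi / 2), B t θ = 0 := by
    intro t ht
    have := intervalIntegral.integral_eq_sub_of_hasDerivAt (a := 0) (b := Real.pi / 2) (fun θ _ =>
      (hasDerivAt_sin_mul_cos_mul_sqrt_div hm1 (Npos t ht θ)).const_mul (m / D t)) (hBint t ht)
    simp only [hB]
    rw [this]
    simp
  have hA0 : ∀ θ ∈ Icc 0 (Real.pi / 2), ∫ t in (0 : ℝ)..φ, A t θ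
      = (1 - m) * Real.sin φ * Real.cos φ * D φ
          / ((1 - (1 - m) * Real.sin φ ^ 2 - m * Real.sin θ ^ 2) * d θ) := by
    intro θ hθ
    have := intervalIntegral.integral_eq_sub_of_hasDerivAt (a := 0) (b := φ)
      (fun t ht => (hasDerivAt_sin_mul_cos_mul_sqrt_div (n := 1 - m * Real.sin θ ^ 2) hq1 (by
        rw [uIcc_of_le hφ0] at ht
        rw [sub_right_comm]
        exact Npos t ht θ)).const_mul ((1 - m) / d θ))
      ((hAct θ hθ).intervalIntegrable_of_Icc hφ0)
    simp only [hA]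
    rw [this]
    have h1 := (Npos φ ⟨hφ0, le_rfl⟩ θ).ne'
    have h3 := (dpos θ).ne'
    rw [sub_right_comm]
    simp only [Real.sin_zero, zero_mul, zero_div, mul_zero, sub_zero, hD]
    field_simp
  have hsum : ∀ t ∈ Icc 0 φ, ∫ θ in (0 : ℝ)..(Real.pi / 2), A t θ
      = (∫ θ in (0 : ℝ)..(Real.pi / 2), d θ) * (1 / D t)
        + (∫ θ in (0 : ℝ)..(Real.pi / 2), 1 / d θ) * D t
        - (∫ θ in (0 : ℝ)..(Real.pi / 2), 1 / d θ) * (1 / D t) := by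
    intro t ht
    have h1 := intervalIntegral.integral_add
      ((hAcθ t ht).intervalIntegrable_of_Icc (μ := volume) hpi2) (hBint t ht)
    rw [hB0 t ht, add_zero] at h1
    rw [← h1, ← intervalIntegral.integral_mul_const, ← intervalIntegral.integral_mul_const,
      ← intervalIntegral.integral_mul_const, ← intervalIntegral.integral_add,
      ← intervalIntegral.integral_sub]
    · exact intervalIntegral.integral_congr fun θ _ => hAB t ht θ
    all_goals exact Continuous.intervalIntegrable (by fun_prop) _ _
  have hfub : ∫ t in (0 : ℝ)..φ, ∫ θ in (0 : ℝ)..(Real.pi / 2), A t θ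
      = ∫ θ in (0 : ℝ)..(Real.pi / 2), ∫ t in (0 : ℝ)..φ, A t θ := by
    refine intervalIntegral_intervalIntegral_swap ?_
    rw [uIoc_of_le hφ0, uIoc_of_le hpi2]
    exact (hAc.integrableOn_compact (isCompact_Icc.prod isCompact_Icc)).mono_set
      (prod_mono Ioc_subset_Icc_self Ioc_subset_Icc_self)
  have hL : ∫ θ in (0 : ℝ)..(Real.pi / 2), ∫ t in (0 : ℝ)..φ, A t θ
      = ∫ θ in (0 : ℝ)..(Real.pi / 2), (1 - m) * Real.sin φ * Real.cos φ * D φ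
          / ((1 - (1 - m) * Real.sin φ ^ 2 - m * Real.sin θ ^ 2) * d θ) :=
    intervalIntegral.integral_congr fun θ hθ => hA0 θ (by rwa [uIcc_of_le hpi2] at hθ)
  have hR : ∫ t in (0 : ℝ)..φ, ∫ θ in (0 : ℝ)..(Real.pi / 2), A t θ = _ :=
    intervalIntegral.integral_congr fun t ht => hsum t (by rwa [uIcc_of_le hφ0] at ht)
  rw [← hL, ← hfub, hR, intervalIntegral.integral_sub, intervalIntegral.integral_add,
    intervalIntegral.integral_const_mul, intervalIntegral.integral_const_mul,
    intervalIntegral.integral_const_mul]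
  all_goals exact Continuous.intervalIntegrable (by fun_prop) _ _

/-- Legendre's form of the complete elliptic integral of the first kind. -/
theorem ellipticK_eq_integral {k : ℝ} :
    ellipticK k = ∫ θ in (0 : ℝ)..(Real.pi / 2), 1 / √(1 - k ^ 2 * Real.sin θ ^ 2) := by
  have hpi := Real.pi_pos
  have h := intervalIntegral.integral_comp_mul_deriv_of_deriv_nonneg (a := 0) (b := Real.pi / 2)
    (f := Real.sin) (f' := Real.cos)
    (g := fun u => 1 / √((1 - u ^ 2) * (1 - k ^ 2 * u ^ 2))) Real.continuous_sin.continuousOn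
    (fun x _ => Real.hasDerivAt_sin x) (fun x hx => by
      rw [min_eq_left (by positivity), max_eq_right (by positivity)] at hx
      exact (Real.cos_pos_of_mem_Ioo ⟨by linarith [hx.1], hx.2⟩).le)
  rw [Real.sin_zero, Real.sin_pi_div_two] at h
  rw [ellipticK, ← h]
  -- After u = sin θ, cancelling cos θ fails at θ = π/2, so the integrands are compared on the open
  -- interval only.
  refine intervalIntegral.integral_congr_Ioo_of_le (by positivity) fun θ hθ => ?_
  have hc := Real.cos_pos_of_mem_Ioo (x := θ) ⟨by linarith [hθ.1], hθ.2⟩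
  simp only [Function.comp]
  rw [← Real.cos_sq', Real.sqrt_mul (sq_nonneg _), Real.sqrt_sq hc.le]
  field_simp

/-- Legendre's form of the complete elliptic integral of the second kind. -/
theorem ellipticE_eq_integral {k : ℝ} :
    ellipticE k = ∫ θ in (0 : ℝ)..(Real.pi / 2), √(1 - k ^ 2 * Real.sin θ ^ 2) := by
  have hpi := Real.pi_pos
  have h := intervalIntegral.integral_comp_mul_deriv_of_deriv_nonneg (a := 0) (b := Real.pi / 2)
    (f := Real.sin) (f' := Real.cos)
    (g := fun u => √(1 - k ^ 2 * u ^ 2) / √(1 - u ^ 2)) Real.continuous_sin.continuousOn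
    (fun x _ => Real.hasDerivAt_sin x) (fun x hx => by
      rw [min_eq_left (by positivity), max_eq_right (by positivity)] at hx
      exact (Real.cos_pos_of_mem_Ioo ⟨by linarith [hx.1], hx.2⟩).le)
  rw [Real.sin_zero, Real.sin_pi_div_two] at h
  rw [ellipticE, ← h]
  refine intervalIntegral.integral_congr_Ioo_of_le (by positivity) fun θ hθ => ?_
  have hc := Real.cos_pos_of_mem_Ioo (x := θ) ⟨by linarith [hθ.1], hθ.2⟩
  simp only [Function.comp]
  rw [← Real.cos_sq', Real.sqrt_sq hc.le]
  field_simp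

/-- Heuman's Lambda function as a complete elliptic integral of the third kind. -/
theorem pi_mul_heumanLambda {k φ : ℝ} (hk0 : 0 < k) (hk1 : k < 1) (hφ0 : 0 ≤ φ)
    (hφ : φ < Real.pi / 2) :
    Real.pi * heumanLambda φ k = 2 * ∫ θ in (0 : ℝ)..(Real.pi / 2),
        (1 - k ^ 2) * Real.sin φ * Real.cos φ * √(1 - (1 - k ^ 2) * Real.sin φ ^ 2)
          / ((1 - (1 - k ^ 2) * Real.sin φ ^ 2 - k ^ 2 * Real.sin θ ^ 2)
            * √(1 - k ^ 2 * Real.sin θ ^ 2)) := by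
  have hk2 : k ^ 2 < 1 := by nlinarith
  rw [integral_circular_thirdKind (by positivity) hk2 hφ0 hφ, heumanLambda, ellipticK_eq_integral,
    ellipticE_eq_integral, incompleteF, incompleteE, Real.sq_sqrt (by linarith)]
  have := Real.pi_ne_zero
  field_simp

/-! ### The explicit formula -/

/-- The explicit form of the closure function. -/
theorem closureIntegral_eq_heumanLambda {α β : ℝ} (hβ : 0 < β) (hαβ : β < α)
    (h9 : α ^ 2 + α * β + β ^ 2 = 9) :
    closureIntegral α β = 2 * √(α * β * (α + β)) / (3 * √(2 * α + β)) * ellipticK (zetaMod α β)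
      + Real.pi * heumanLambda (Real.arcsin √((chiChar α β - zetaMod α β ^ 2)
          / (chiChar α β * (1 - zetaMod α β ^ 2)))) (zetaMod α β) := by
  have hα : 0 < α := hβ.trans hαβ
  have hsub : 0 < α - β := sub_pos.2 hαβ
  have hs : 0 < 2 * α + β := by positivity
  have hζ2 : zetaMod α β ^ 2 = (α - β) / (2 * α + β) :=
    Real.sq_sqrt (div_nonneg hsub.le hs.le)
  have hζ0 : 0 < zetaMod α β := Real.sqrt_pos.2 (div_pos hsub hs)
  have hζ1 : zetaMod α β < 1 := by
    have : zetaMod α β ^ 2 < 1 := by rw [hζ2, div_lt_one hs]; linarith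
    nlinarith
  -- The relation α² + αβ + β² = 9 gives 9α − αβ(α+β) = α³.
  have hn : chiChar α β = 9 * (α - β) / α ^ 3 := by
    unfold chiChar
    congr 1
    linear_combination -α * h9
  have harg : (chiChar α β - zetaMod α β ^ 2) / (chiChar α β * (1 - zetaMod α β ^ 2))
      = (α + β) ^ 3 / (9 * (α + 2 * β)) := by
    have e1 : 1 - (α - β) / (2 * α + β) = (α + 2 * β) / (2 * α + β) := by
      field_simp; ring
    have e2 : 9 * (α - β) / α ^ 3 - (α - β) / (2 * α + β)
        = (α - β) * (α + β) ^ 3 / (α ^ 3 * (2 * α + β)) := by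
      rw [← h9]; field_simp; ring
    rw [hζ2, hn, e1, e2]
    field_simp
  rw [harg]
  set x : ℝ := (α + β) ^ 3 / (9 * (α + 2 * β)) with hx
  have hx0 : 0 ≤ x := by positivity
  have hx1 : 1 - x = β ^ 3 / (9 * (α + 2 * β)) := by
    rw [hx, ← h9]; field_simp; ring
  have hx1' : x < 1 := by
    have : 0 < β ^ 3 / (9 * (α + 2 * β)) := by positivity
    linarith
  set φ := Real.arcsin √x with hφ
  have hφ0 : 0 ≤ φ := Real.arcsin_nonneg.2 (Real.sqrt_nonneg _)
  have hφ1 : φ < Real.pi / 2 := by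
    rw [hφ, Real.arcsin_lt_pi_div_two, Real.sqrt_lt' one_pos, one_pow]
    exact hx1'
  have hsin : Real.sin φ = √x := Real.sin_arcsin (by linarith [Real.sqrt_nonneg x])
    (Real.sqrt_le_one.2 hx1'.le)
  have hcos : Real.cos φ = √(1 - x) := by rw [hφ, Real.cos_arcsin, Real.sq_sqrt hx0]
  rw [pi_mul_heumanLambda hζ0 hζ1 hφ0 hφ1, hsin, hcos, Real.sq_sqrt hx0, ellipticK_eq_integral,
    hζ2]
  set c := α * β * (α + β) with hc
  have hc0 : 0 < c := by positivity
  set S := √(2 * α + β) with hS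
  have hS0 : 0 < S := Real.sqrt_pos.2 hs
  have hS2 : S ^ 2 = 2 * α + β := Real.sq_sqrt hs.le
  have hD : 1 - (1 - (α - β) / (2 * α + β)) * x = α ^ 3 / (9 * (2 * α + β)) := by
    rw [hx, ← h9]; field_simp; ring
  -- Both sides are positive and are compared after squaring. The factors x, 1 − x and 1 − (1−ζ²)x
  -- carry the cubes (α+β)³, β³ and α³, whose product is c³.
  have hpre : (1 - (α - β) / (2 * α + β)) * √x * √(1 - x)
      * √(1 - (1 - (α - β) / (2 * α + β)) * x) = c * √c / (27 * S ^ 3) := by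
    have e1 : 1 - (α - β) / (2 * α + β) = (α + 2 * β) / (2 * α + β) := by
      field_simp; ring
    rw [hD, e1, hx1, ← sq_eq_sq₀ (by positivity) (by positivity)]
    simp only [mul_pow, div_pow]
    rw [Real.sq_sqrt hx0, Real.sq_sqrt (by positivity), Real.sq_sqrt (by positivity),
      Real.sq_sqrt hc0.le, ← pow_mul, mul_comm 3 2, pow_mul, hS2, hx, hc]
    field_simp
    norm_num
  have kpos' := elasticProfile_add_pos hβ hαβ
  have dpos := elasticProfile_denom_pos hβ hαβ h9
  rw [← hc] at dpos
  have hd : ∀ θ, √(1 - (α - β) / (2 * α + β) * Real.sin θ ^ 2)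
      = √(elasticProfile α β θ + α + β) / S := by
    intro θ
    rw [hS, ← Real.sqrt_div' _ hs.le]
    congr 1
    unfold elasticProfile
    field_simp
    ring
  have hN : ∀ θ, 1 - (1 - (α - β) / (2 * α + β)) * x - (α - β) / (2 * α + β) * Real.sin θ ^ 2
      = (9 * elasticProfile α β θ - c) / (9 * S ^ 2) := by
    intro θ
    rw [hD, hS2, hc]
    unfold elasticProfile
    field_simp
    linear_combination α * h9
  rw [hpre]
  simp only [hd, hN]
  unfold closureIntegral
  rw [← hc]
  have kc : Continuous (elasticProfile α β) := continuous_elasticProfile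
  have i1 : IntervalIntegrable (fun θ => 2 * √c / (3 * S) * (1 / (√(elasticProfile α β θ + α + β) / S)))
      volume 0 (Real.pi / 2) := by
    refine Continuous.intervalIntegrable ?_ _ _
    refine continuous_const.mul (continuous_const.div (by fun_prop) fun θ => ?_)
    exact (div_pos (Real.sqrt_pos.2 (kpos' θ)) hS0).ne'
  have i2 : IntervalIntegrable (fun θ => 2 * (c * √c / (27 * S ^ 3)
      / ((9 * elasticProfile α β θ - c) / (9 * S ^ 2) * (√(elasticProfile α β θ + α + β) / S))))
      volume 0 (Real.pi / 2) := by
    refine Continuous.intervalIntegrable ?_ _ _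
    refine continuous_const.mul (continuous_const.div (by fun_prop) fun θ => ?_)
    exact (mul_pos (div_pos (dpos θ) (by positivity))
      (div_pos (Real.sqrt_pos.2 (kpos' θ)) hS0)).ne'
  rw [← intervalIntegral.integral_const_mul, ← intervalIntegral.integral_const_mul,
    ← intervalIntegral.integral_const_mul, ← intervalIntegral.integral_add i1 i2]
  refine intervalIntegral.integral_congr fun θ _ => ?_
  have h1 := (Real.sqrt_pos.2 (kpos' θ)).ne'
  have h2 := (dpos θ).ne'
  -- The first summand cancels the pole and gives the term in K(ζ); the second gives the third-kind
  -- integral.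
  have h3 : elasticProfile α β θ = (9 * elasticProfile α β θ - c) / 9 + c / 9 := by ring
  generalize √(elasticProfile α β θ + α + β) = Z at *
  generalize 9 * elasticProfile α β θ - c = e at *
  rw [h3]
  field_simp
  ring

/-! ### The trisected angle and the monotone kernel -/

/-- The angle `τ ∈ (-π/6, π/6)` with `sin (3τ/2) = y / √(1 + 2y²)`, so that
`cos (3τ) = 1 / (1 + 2y²)`. -/
def trisectedAngle (y : ℝ) : ℝ := 2 / 3 * Real.arcsin (y / √(1 + 2 * y ^ 2))

theorem one_add_two_mul_sq_pos (y : ℝ) : 0 < 1 + 2 * y ^ 2 := by positivity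

theorem sqrt_one_add_two_mul_sq_pos (y : ℝ) : 0 < √(1 + 2 * y ^ 2) :=
  Real.sqrt_pos.2 (one_add_two_mul_sq_pos y)

theorem div_sqrt_one_add_two_mul_sq_sq (y : ℝ) :
    (y / √(1 + 2 * y ^ 2)) ^ 2 = y ^ 2 / (1 + 2 * y ^ 2) := by
  rw [div_pow, Real.sq_sqrt (one_add_two_mul_sq_pos y).le]

theorem one_sub_div_sqrt_one_add_two_mul_sq_sq (y : ℝ) :
    1 - (y / √(1 + 2 * y ^ 2)) ^ 2 = (1 + y ^ 2) / (1 + 2 * y ^ 2) := by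
  rw [div_sqrt_one_add_two_mul_sq_sq]
  have := (one_add_two_mul_sq_pos y).ne'
  field_simp
  ring

theorem abs_div_sqrt_one_add_two_mul_sq_lt (y : ℝ) : |y / √(1 + 2 * y ^ 2)| < 1 := by
  rw [← sq_lt_one_iff_abs_lt_one, ← sub_pos, one_sub_div_sqrt_one_add_two_mul_sq_sq]
  positivity

theorem sin_three_halves_trisectedAngle (y : ℝ) :
    Real.sin (3 / 2 * trisectedAngle y) = y / √(1 + 2 * y ^ 2) := by
  have h := abs_lt.1 (abs_div_sqrt_one_add_two_mul_sq_lt y)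
  rw [trisectedAngle, ← mul_assoc, show (3 / 2 : ℝ) * (2 / 3) = 1 by norm_num, one_mul,
    Real.sin_arcsin h.1.le h.2.le]

theorem cos_three_halves_trisectedAngle (y : ℝ) :
    Real.cos (3 / 2 * trisectedAngle y) = √(1 + y ^ 2) / √(1 + 2 * y ^ 2) := by
  rw [trisectedAngle, ← mul_assoc, show (3 / 2 : ℝ) * (2 / 3) = 1 by norm_num, one_mul,
    Real.cos_arcsin, one_sub_div_sqrt_one_add_two_mul_sq_sq, Real.sqrt_div (by positivity)]

theorem cos_three_mul_trisectedAngle (y : ℝ) :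
    Real.cos (3 * trisectedAngle y) = 1 / (1 + 2 * y ^ 2) := by
  rw [show 3 * trisectedAngle y = 2 * (3 / 2 * trisectedAngle y) by ring, Real.cos_two_mul,
    Real.cos_sq', sin_three_halves_trisectedAngle, div_sqrt_one_add_two_mul_sq_sq]
  have := (one_add_two_mul_sq_pos y).ne'
  field_simp
  ring

theorem trisectedAngle_neg (y : ℝ) : trisectedAngle (-y) = -trisectedAngle y := by
  simp [trisectedAngle, neg_div, Real.arcsin_neg]

theorem trisectedAngle_zero : trisectedAngle 0 = 0 := by simp [trisectedAngle]

theorem hasDerivAt_div_sqrt_one_add_two_mul_sq (y : ℝ) :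
    HasDerivAt (fun y : ℝ => y / √(1 + 2 * y ^ 2)) (1 / ((1 + 2 * y ^ 2) * √(1 + 2 * y ^ 2))) y := by
  have h1 : HasDerivAt (fun y : ℝ => √(1 + 2 * y ^ 2)) _ y :=
    ((((hasDerivAt_id y).pow 2).const_mul 2).const_add 1).sqrt (one_add_two_mul_sq_pos y).ne'
  refine ((hasDerivAt_id y).div h1 (sqrt_one_add_two_mul_sq_pos y).ne').congr_deriv ?_
  have h2 := (sqrt_one_add_two_mul_sq_pos y).ne'
  have h3 := Real.sq_sqrt (one_add_two_mul_sq_pos y).le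
  have h4 := (one_add_two_mul_sq_pos y).ne'
  simp only [Pi.pow_apply, id]
  field_simp
  rw [h3]
  norm_num
  ring

theorem hasDerivAt_trisectedAngle (y : ℝ) :
    HasDerivAt trisectedAngle (2 / (3 * (1 + 2 * y ^ 2) * √(1 + y ^ 2))) y := by
  have h := abs_lt.1 (abs_div_sqrt_one_add_two_mul_sq_lt y)
  have h1 : HasDerivAt trisectedAngle _ y :=
    ((Real.hasDerivAt_arcsin h.1.ne' h.2.ne).comp y
      (hasDerivAt_div_sqrt_one_add_two_mul_sq y)).const_mul (2 / 3)
  refine h1.congr_deriv ?_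
  rw [one_sub_div_sqrt_one_add_two_mul_sq_sq, Real.sqrt_div (by positivity)]
  have := (sqrt_one_add_two_mul_sq_pos y).ne'
  field_simp

theorem continuous_trisectedAngle : Continuous trisectedAngle :=
  continuous_iff_continuousAt.2 fun y => (hasDerivAt_trisectedAngle y).continuousAt

theorem strictMono_trisectedAngle : StrictMono trisectedAngle := by
  refine strictMono_of_deriv_pos fun y => ?_
  rw [(hasDerivAt_trisectedAngle y).deriv]
  positivity

theorem tendsto_trisectedAngle_atTop : Tendsto trisectedAngle atTop (𝓝 (Real.pi / 6)) := by
  have h1 : Tendsto (fun y : ℝ => 1 / √(1 / y ^ 2 + 2)) atTop (𝓝 (1 / √(0 + 2))) := by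
    refine Tendsto.div tendsto_const_nhds ?_ (by positivity)
    refine (Real.continuous_sqrt.tendsto _).comp (Tendsto.add ?_ tendsto_const_nhds)
    simp only [one_div]
    exact (tendsto_pow_atTop (α := ℝ) two_ne_zero).inv_tendsto_atTop
  have h2 : Tendsto (fun y : ℝ => y / √(1 + 2 * y ^ 2)) atTop (𝓝 (1 / √(0 + 2))) := by
    refine h1.congr' ?_
    filter_upwards [eventually_gt_atTop 0] with y hy
    have : 1 + 2 * y ^ 2 = y ^ 2 * (1 / y ^ 2 + 2) := by field_simp
    rw [this, Real.sqrt_mul (by positivity), Real.sqrt_sq hy.le]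
    field_simp
  -- The limit 1/√2 of the argument is sin(π/4), and 2/3 · π/4 = π/6.
  have h3 : Real.pi / 6 = 2 / 3 * Real.arcsin (1 / √(0 + 2)) := by
    have : (1 : ℝ) / √(0 + 2) = Real.sin (Real.pi / 4) := by
      rw [Real.sin_pi_div_four, zero_add, div_eq_div_iff (by positivity) (by norm_num)]
      norm_num
    rw [this, Real.arcsin_sin] <;> linarith [Real.pi_pos]
  rw [h3]
  exact ((Real.continuous_arcsin.tendsto _).comp h2).const_mul _

theorem trisectedAngle_lt (y : ℝ) : trisectedAngle y < Real.pi / 6 :=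
  (strictMono_trisectedAngle (lt_add_one y)).trans_le
    (strictMono_trisectedAngle.monotone.ge_of_tendsto tendsto_trisectedAngle_atTop _)

theorem neg_lt_trisectedAngle (y : ℝ) : -(Real.pi / 6) < trisectedAngle y := by
  have := trisectedAngle_lt (-y)
  rw [trisectedAngle_neg] at this
  linarith

theorem cos_trisectedAngle_pos (y : ℝ) : 0 < Real.cos (trisectedAngle y) :=
  Real.cos_pos_of_mem_Ioo ⟨by linarith [neg_lt_trisectedAngle y, Real.pi_pos],
    by linarith [trisectedAngle_lt y, Real.pi_pos]⟩

/-- The quotient `cos 2σ / cos (3σ/2)` is strictly decreasing on `[0, π/6]`. -/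
theorem strictAntiOn_cos_div_cos :
    StrictAntiOn (fun σ : ℝ => Real.cos (2 * σ) / Real.cos (3 / 2 * σ)) (Icc 0 (Real.pi / 6)) := by
  intro x hx y hy hxy
  have hpi := Real.pi_pos
  have hpos : ∀ z ∈ Icc 0 (Real.pi / 6), 0 < Real.cos (3 / 2 * z) := fun z hz =>
    Real.cos_pos_of_mem_Ioo ⟨by linarith [hz.1], by linarith [hz.2]⟩
  simp only
  rw [div_lt_div_iff₀ (hpos y hy) (hpos x hx)]
  have e1 : ∀ u v, Real.cos u * Real.cos v = (Real.cos (u + v) + Real.cos (u - v)) / 2 := by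
    intro u v
    rw [Real.cos_add, Real.cos_sub]; ring
  -- Product-to-sum reduces the cross-multiplied inequality to two comparisons of cosines: 2x + 3y/2
  -- < 2y + 3x/2 and |2x − 3y/2| < 2y − 3x/2.
  rw [e1, e1]
  have l1 : Real.cos (2 * y + 3 / 2 * x) < Real.cos (2 * x + 3 / 2 * y) :=
    Real.cos_lt_cos_of_nonneg_of_le_pi (by linarith [hx.1, hy.1]) (by linarith [hx.2, hy.2])
      (by linarith)
  have l2 : Real.cos (2 * y - 3 / 2 * x) < Real.cos (2 * x - 3 / 2 * y) := by
    rw [← Real.cos_abs (2 * x - 3 / 2 * y)]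
    refine Real.cos_lt_cos_of_nonneg_of_le_pi (abs_nonneg _) (by linarith [hx.1, hy.2])
      (abs_lt.2 ⟨by linarith [hx.1], by linarith⟩)
  linarith

/-- The integrand of the closure function in its monotone form. -/
def closureKernel (y : ℝ) : ℝ :=
  Real.cos (2 * trisectedAngle y) / Real.cos (3 / 2 * trisectedAngle y)

theorem cos_three_halves_trisectedAngle_pos (y : ℝ) :
    0 < Real.cos (3 / 2 * trisectedAngle y) := by
  rw [cos_three_halves_trisectedAngle]
  positivity

theorem continuous_closureKernel : Continuous closureKernel := by
  have := continuous_trisectedAngle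
  exact Continuous.div (by fun_prop) (by fun_prop) fun y => (cos_three_halves_trisectedAngle_pos y).ne'

theorem trisectedAngle_mem_Icc {y : ℝ} (hy : 0 ≤ y) : trisectedAngle y ∈ Icc 0 (Real.pi / 6) :=
  ⟨trisectedAngle_zero ▸ strictMono_trisectedAngle.monotone hy, (trisectedAngle_lt y).le⟩

theorem strictAntiOn_closureKernel : StrictAntiOn closureKernel (Ici 0) := fun _ hx _ hy hxy =>
  strictAntiOn_cos_div_cos (trisectedAngle_mem_Icc hx) (trisectedAngle_mem_Icc hy)
    (strictMono_trisectedAngle hxy)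

theorem closureKernel_zero : closureKernel 0 = 1 := by simp [closureKernel, trisectedAngle_zero]

theorem tendsto_closureKernel_atTop : Tendsto closureKernel atTop (𝓝 (1 / √2)) := by
  have h : (1 : ℝ) / √2 = Real.cos (2 * (Real.pi / 6)) / Real.cos (3 / 2 * (Real.pi / 6)) := by
    rw [show 2 * (Real.pi / 6) = Real.pi / 3 by ring, show 3 / 2 * (Real.pi / 6) = Real.pi / 4 by ring,
      Real.cos_pi_div_three, Real.cos_pi_div_four]
    field_simp
  rw [h]
  have h2 : Real.cos (3 / 2 * (Real.pi / 6)) ≠ 0 := by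
    rw [show 3 / 2 * (Real.pi / 6) = Real.pi / 4 by ring, Real.cos_pi_div_four]
    positivity
  exact ((Real.continuous_cos.tendsto _).comp (tendsto_trisectedAngle_atTop.const_mul _)).div
    ((Real.continuous_cos.tendsto _).comp (tendsto_trisectedAngle_atTop.const_mul _)) h2

/-- The closure function in its monotone form. -/
def monotoneClosure (l : ℝ) : ℝ :=
  2 * √2 * ∫ ψ in (0 : ℝ)..(Real.pi / 2), closureKernel (l * Real.sin ψ)

theorem strictAntiOn_monotoneClosure : StrictAntiOn monotoneClosure (Ici 0) := by
  intro x hx y hy hxy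
  have hpi : 0 < Real.pi / 2 := by positivity
  have hc : ∀ l : ℝ, Continuous fun ψ => closureKernel (l * Real.sin ψ) := fun l => by
    have := continuous_closureKernel
    fun_prop
  refine mul_lt_mul_of_pos_left ?_ (by positivity)
  -- At ψ = 0 the integrands agree; strictness is needed at only one point, and ψ = π/2 serves,
  -- where the argument is l itself.
  refine intervalIntegral.integral_lt_integral_of_continuousOn_of_le_of_exists_lt hpi
    (hc y).continuousOn (hc x).continuousOn (fun ψ hψ => ?_) ⟨Real.pi / 2, ⟨hpi.le, le_rfl⟩, ?_⟩
  · have hs : 0 ≤ Real.sin ψ := Real.sin_nonneg_of_nonneg_of_le_pi hψ.1.le (by linarith [hψ.2])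
    exact strictAntiOn_closureKernel.antitoneOn (mul_nonneg hx hs) (mul_nonneg hy hs)
      (mul_le_mul_of_nonneg_right hxy.le hs)
  · simp only [Real.sin_pi_div_two, mul_one]
    exact strictAntiOn_closureKernel hx hy hxy

theorem continuous_monotoneClosure : Continuous monotoneClosure := by
  have := continuous_closureKernel
  refine continuous_const.mul (intervalIntegral.continuous_parametric_intervalIntegral_of_continuous' ?_ _ _)
  fun_prop

theorem monotoneClosure_zero : monotoneClosure 0 = √2 * Real.pi := by
  simp only [monotoneClosure, zero_mul, closureKernel_zero]
  simp
  ring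

theorem tendsto_monotoneClosure_atTop : Tendsto monotoneClosure atTop (𝓝 Real.pi) := by
  have hpi : 0 < Real.pi / 2 := by positivity
  have e : Real.pi = 2 * √2 * ∫ _ in (0 : ℝ)..(Real.pi / 2), 1 / √2 := by
    simp
    field_simp
  conv => rhs; rw [e]
  refine Tendsto.const_mul _ ?_
  -- The bound 1 is the kernel's value at 0. Pointwise convergence to 1/√2 needs sin ψ > 0; the
  -- excluded endpoint ψ = 0 is harmless.
  refine intervalIntegral.tendsto_integral_filter_of_dominated_convergence (fun _ => 1) ?_ ?_ ?_ ?_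
  · refine Eventually.of_forall fun l => Continuous.aestronglyMeasurable ?_
    have := continuous_closureKernel
    fun_prop
  · filter_upwards [eventually_ge_atTop 0] with l hl
    refine Eventually.of_forall fun ψ hψ => ?_
    rw [uIoc_of_le hpi.le] at hψ
    have hs : 0 ≤ l * Real.sin ψ :=
      mul_nonneg hl (Real.sin_nonneg_of_nonneg_of_le_pi hψ.1.le (by linarith [hψ.2]))
    have h0 : 0 ≤ closureKernel (l * Real.sin ψ) := by
      have h1 := trisectedAngle_mem_Icc hs
      exact div_nonneg (Real.cos_nonneg_of_mem_Icc ⟨by linarith [h1.1], by linarith [h1.2]⟩)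
        (cos_three_halves_trisectedAngle_pos _).le
    rw [Real.norm_of_nonneg h0, ← closureKernel_zero]
    exact strictAntiOn_closureKernel.antitoneOn (mem_Ici.2 le_rfl) hs hs
  · exact intervalIntegrable_const
  · refine Eventually.of_forall fun ψ hψ => ?_
    rw [uIoc_of_le hpi.le] at hψ
    have hs : 0 < Real.sin ψ := Real.sin_pos_of_pos_of_lt_pi hψ.1 (by linarith [hψ.2])
    exact tendsto_closureKernel_atTop.comp (tendsto_id.atTop_mul_const hs)

/-! ### From the phase angle to the monotone kernel -/

/-- Adding an exact differential removes the pole of the integrand at `κ = c / 9`. -/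
theorem closureIntegral_eq_integral_nine_sub_sq {α β : ℝ} (hβ : 0 < β) (hαβ : β < α)
    (h9 : α ^ 2 + α * β + β ^ 2 = 9) :
    closureIntegral α β = ∫ θ in (0 : ℝ)..(Real.pi / 2), 12 * √(α * β * (α + β))
      / ((9 - elasticProfile α β θ ^ 2) * √(elasticProfile α β θ + α + β)) := by
  have hα : 0 < α := hβ.trans hαβ
  have kpos := elasticProfile_pos hβ hαβ
  have kpos' := elasticProfile_add_pos hβ hαβ
  have dpos := elasticProfile_denom_pos hβ hαβ h9
  have npos : ∀ θ, 0 < 9 - elasticProfile α β θ ^ 2 := fun θ => by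
    have h1 := (elasticProfile_mem_Icc hαβ θ).2
    have h2 := kpos θ
    nlinarith
  have hF := rootFactor_sq hβ hαβ h9
  have kc : Continuous (elasticProfile α β) := continuous_elasticProfile
  unfold closureIntegral
  set c := α * β * (α + β) with hc
  have hc0 : 0 < c := by positivity
  have hC := Real.sqrt_pos.2 hc0
  have hC2 := Real.sq_sqrt hc0.le
  set f : ℝ → ℝ := fun θ => 3 * ((α - β) * Real.sin θ * Real.cos θ
    * √(elasticProfile α β θ + α + β)) / (√c * elasticProfile α β θ) with hf
  set g : ℝ → ℝ := fun θ => 12 * √c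
      / ((9 - elasticProfile α β θ ^ 2) * √(elasticProfile α β θ + α + β)) -
      6 * √c * (elasticProfile α β θ / ((9 * elasticProfile α β θ - c)
        * √(elasticProfile α β θ + α + β))) with hg
  have c1 : Continuous fun θ => 12 * √c
      / ((9 - elasticProfile α β θ ^ 2) * √(elasticProfile α β θ + α + β)) :=
    continuous_const.div (by fun_prop) fun θ =>
      (mul_pos (npos θ) (Real.sqrt_pos.2 (kpos' θ))).ne'
  have c2 : Continuous fun θ => 6 * √c * (elasticProfile α β θ / ((9 * elasticProfile α β θ - c)
        * √(elasticProfile α β θ + α + β))) :=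
    continuous_const.mul (kc.div (by fun_prop) fun θ =>
      (mul_pos (dpos θ) (Real.sqrt_pos.2 (kpos' θ))).ne')
  have hd : ∀ θ, HasDerivAt (fun θ => 2 * Real.arctan (f θ)) (g θ) θ := by
    intro θ
    have hk := (kpos θ).ne'
    have hz := Real.sqrt_pos.2 (kpos' θ)
    have h1 : HasDerivAt f _ θ := ((hasDerivAt_rootFactor hβ hαβ h9 θ).const_mul 3).div
      ((hasDerivAt_elasticProfile (α := α) (β := β) θ).const_mul √c) (mul_pos hC (kpos θ)).ne'
    refine (h1.arctan.const_mul 2).congr_deriv ?_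
    have hF1 := hF θ
    -- The choice of f rests on 9P(k) + ck² = (9k − c)(9 − k²): the derivative of arctan f then has
    -- exactly the old and the new denominator. At θ = 0 and π/2, f vanishes.
    have e1 : 1 + f θ ^ 2 = (9 * elasticProfile α β θ - c) * (9 - elasticProfile α β θ ^ 2)
        / (c * elasticProfile α β θ ^ 2) := by
      simp only [hf]
      rw [div_pow, mul_pow 3, hF1, mul_pow, hC2]
      field_simp
      ring
    rw [e1]
    simp only [hg]
    have h2 := (dpos θ).ne'
    have h3 := (npos θ).ne'
    have h4 := hz.ne'
    have h5 := hC.ne'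
    generalize elasticProfile α β θ = k at *
    generalize hZ : √(k + α + β) = Z at *
    generalize hSC : (α - β) * Real.sin θ * Real.cos θ = u at *
    have h6 : 2 * (α - β) * Real.sin θ * Real.cos θ = 2 * u := by rw [← hSC]; ring
    rw [h6]
    rw [← hC2] at h2 hF1 ⊢
    generalize √c = C at *
    field_simp
    rw [Real.sqrt_sq hC.le]
    linear_combination 12 * C ^ 2 * hF1
  have hint := intervalIntegral.integral_eq_sub_of_hasDerivAt (a := 0) (b := Real.pi / 2)
    (fun θ _ => hd θ) ((c1.sub c2).intervalIntegrable _ _)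
  rw [intervalIntegral.integral_sub (c1.intervalIntegrable _ _) (c2.intervalIntegrable _ _),
    intervalIntegral.integral_const_mul] at hint
  have e0 : 2 * Real.arctan (f (Real.pi / 2)) - 2 * Real.arctan (f 0) = 0 := by simp [hf]
  rw [e0] at hint
  linarith

/-- The closure function as an integral over the range of the curvature. -/
theorem closureIntegral_eq_integral_curvature {α β : ℝ} (hβ : 0 < β) (hαβ : β < α)
    (h9 : α ^ 2 + α * β + β ^ 2 = 9) :
    closureIntegral α β = ∫ x in β..α, 6 * √(α * β * (α + β))
      / ((9 - x ^ 2) * √(-x ^ 3 + 9 * x - α * β * (α + β))) := by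
  have hpi : 0 < Real.pi / 2 := by positivity
  have hsub : 0 < α - β := sub_pos.2 hαβ
  have hsc : ∀ θ ∈ Ioo 0 (Real.pi / 2), 0 < Real.sin θ ∧ 0 < Real.cos θ := fun θ hθ =>
    ⟨Real.sin_pos_of_pos_of_lt_pi hθ.1 (by linarith [hθ.2]),
      Real.cos_pos_of_mem_Ioo ⟨by linarith [hθ.1], hθ.2⟩⟩
  have h := intervalIntegral.integral_comp_mul_deriv_of_deriv_nonpos (a := 0) (b := Real.pi / 2)
    (f := elasticProfile α β) (g := fun x => 6 * √(α * β * (α + β))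
      / ((9 - x ^ 2) * √(-x ^ 3 + 9 * x - α * β * (α + β))))
    continuous_elasticProfile.continuousOn (fun θ _ => hasDerivAt_elasticProfile θ)
    (fun θ hθ => by
      rw [min_eq_left hpi.le, max_eq_right hpi.le] at hθ
      obtain ⟨h1, h2⟩ := hsc θ hθ
      have : 0 < 2 * (α - β) * Real.sin θ * Real.cos θ := by positivity
      linarith)
  have e0 : elasticProfile α β 0 = α := by simp [elasticProfile]
  have e1 : elasticProfile α β (Real.pi / 2) = β := by simp [elasticProfile]
  rw [e0, e1] at h
  rw [intervalIntegral.integral_symm, ← h, ← intervalIntegral.integral_neg,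
    closureIntegral_eq_integral_nine_sub_sq hβ hαβ h9]
  refine intervalIntegral.integral_congr_Ioo_of_le hpi.le fun θ hθ => ?_
  obtain ⟨h1, h2⟩ := hsc θ hθ
  have h3 := Real.sqrt_pos.2 (elasticProfile_add_pos hβ hαβ θ)
  simp only [Function.comp]
  rw [← rootFactor_sq hβ hαβ h9, Real.sqrt_sq (by positivity)]
  field_simp
  ring

/-- The curvature in terms of the tangent-like parameter `y` for which
`κ(9 - κ²) = 6√3 / (1 + 2y²)`. -/
def trisectedCurvature (y : ℝ) : ℝ :=
  √3 * Real.cos (trisectedAngle y) + 3 * Real.sin (trisectedAngle y)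

theorem cos_trisectedAngle_cubic (y : ℝ) :
    4 * Real.cos (trisectedAngle y) ^ 3 - 3 * Real.cos (trisectedAngle y) = 1 / (1 + 2 * y ^ 2) := by
  rw [← Real.cos_three_mul, cos_three_mul_trisectedAngle]

theorem trisectedCurvature_neg (y : ℝ) : trisectedCurvature (-y)
    = √3 * Real.cos (trisectedAngle y) - 3 * Real.sin (trisectedAngle y) := by
  simp [trisectedCurvature, trisectedAngle_neg, sub_eq_add_neg]

/-- Viète's trigonometric solution: κ = 2√3 cos(τ − π/3), so κ(9 − κ²) = 6√3 cos 3τ by the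
triple-angle formula. Thus y and −y give the two positive roots for the same constant. -/
theorem trisectedCurvature_mul_nine_sub_sq (y : ℝ) :
    trisectedCurvature y * (9 - trisectedCurvature y ^ 2) = 6 * √3 / (1 + 2 * y ^ 2) := by
  have h1 := cos_trisectedAngle_cubic y
  have h2 := Real.sin_sq (trisectedAngle y)
  have h3 : √3 ^ 2 = 3 := Real.sq_sqrt (by norm_num)
  rw [div_eq_mul_one_div, ← h1, trisectedCurvature]
  generalize Real.cos (trisectedAngle y) = C at *
  generalize Real.sin (trisectedAngle y) = S at *
  linear_combination (-27 * √3 * C - 27 * S) * h2 + (-√3 * C ^ 3 - 9 * C ^ 2 * S) * h3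

theorem trisectedCurvature_sq_add (y : ℝ) :
    trisectedCurvature y ^ 2 + trisectedCurvature y * trisectedCurvature (-y)
      + trisectedCurvature (-y) ^ 2 = 9 := by
  have h2 := Real.sin_sq (trisectedAngle y)
  have h3 : √3 ^ 2 = 3 := Real.sq_sqrt (by norm_num)
  rw [trisectedCurvature_neg, trisectedCurvature]
  linear_combination 9 * h2 + 3 * Real.cos (trisectedAngle y) ^ 2 * h3

theorem trisectedCurvature_mul_add (y : ℝ) :
    trisectedCurvature y * trisectedCurvature (-y)
      * (trisectedCurvature y + trisectedCurvature (-y)) = 6 * √3 / (1 + 2 * y ^ 2) := by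
  rw [← trisectedCurvature_mul_nine_sub_sq, ← trisectedCurvature_sq_add y]
  ring

theorem trisectedCurvature_neg_lt {y : ℝ} (hy : 0 < y) :
    trisectedCurvature (-y) < trisectedCurvature y := by
  have h1 : 0 < trisectedAngle y := trisectedAngle_zero ▸ strictMono_trisectedAngle hy
  have h2 := Real.sin_pos_of_pos_of_lt_pi h1 (by linarith [trisectedAngle_lt y, Real.pi_pos])
  rw [trisectedCurvature_neg, trisectedCurvature]
  linarith

/-- Since cos 3τ = C(4C² − 3) and C = cos τ are both positive, 4C² > 3. This algebraic form of |τ| <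
π/6 gives both κ > 0 and dκ/dτ > 0. -/
theorem three_mul_sin_sq_lt_cos_sq (y : ℝ) :
    3 * Real.sin (trisectedAngle y) ^ 2 < Real.cos (trisectedAngle y) ^ 2 := by
  have h1 := cos_trisectedAngle_cubic y
  have h2 := Real.sin_sq (trisectedAngle y)
  have h3 : 0 < 1 / (1 + 2 * y ^ 2) := by positivity
  have h4 := cos_trisectedAngle_pos y
  have h5 : 0 < 4 * Real.cos (trisectedAngle y) ^ 2 - 3 := by
    refine pos_of_mul_pos_right (a := Real.cos (trisectedAngle y)) ?_ h4.le
    linarith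
  linarith

theorem trisectedCurvature_pos (y : ℝ) : 0 < trisectedCurvature y := by
  have h1 := three_mul_sin_sq_lt_cos_sq y
  have h4 := cos_trisectedAngle_pos y
  have h3 : √3 ^ 2 = 3 := Real.sq_sqrt (by norm_num)
  have h5 : (0 : ℝ) < √3 := by positivity
  have h6 : |3 * Real.sin (trisectedAngle y)| < √3 * Real.cos (trisectedAngle y) := by
    refine abs_lt_of_sq_lt_sq ?_ (by positivity)
    rw [mul_pow, mul_pow, h3]
    linarith
  rw [trisectedCurvature]
  linarith [(abs_lt.1 h6).1]

theorem hasDerivAt_trisectedCurvature (y : ℝ) :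
    HasDerivAt trisectedCurvature ((3 * Real.cos (trisectedAngle y)
      - √3 * Real.sin (trisectedAngle y)) * (2 / (3 * (1 + 2 * y ^ 2) * √(1 + y ^ 2)))) y := by
  have h := hasDerivAt_trisectedAngle y
  have h1 : HasDerivAt trisectedCurvature _ y := (h.cos.const_mul √3).add (h.sin.const_mul 3)
  refine h1.congr_deriv ?_
  ring

theorem deriv_trisectedCurvature_factor_pos (y : ℝ) :
    0 < 3 * Real.cos (trisectedAngle y) - √3 * Real.sin (trisectedAngle y) := by
  have h1 := three_mul_sin_sq_lt_cos_sq y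
  have h4 := cos_trisectedAngle_pos y
  have h3 : √3 ^ 2 = 3 := Real.sq_sqrt (by norm_num)
  have h6 : |√3 * Real.sin (trisectedAngle y)| < 3 * Real.cos (trisectedAngle y) := by
    refine abs_lt_of_sq_lt_sq ?_ (by positivity)
    rw [mul_pow, mul_pow, h3]
    nlinarith
  linarith [(abs_lt.1 h6).2]

/-- The closure function is the integral of a monotone kernel. -/
theorem closureIntegral_eq_monotoneClosure {l : ℝ} (hl : 0 < l) :
    closureIntegral (trisectedCurvature l) (trisectedCurvature (-l)) = monotoneClosure l := by
  have hpi : 0 < Real.pi / 2 := by positivity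
  rw [closureIntegral_eq_integral_curvature (trisectedCurvature_pos _)
    (trisectedCurvature_neg_lt hl) (trisectedCurvature_sq_add l), trisectedCurvature_mul_add]
  have hd : ∀ ψ, HasDerivAt (fun ψ => trisectedCurvature (l * Real.sin ψ))
      ((3 * Real.cos (trisectedAngle (l * Real.sin ψ)) - √3 * Real.sin (trisectedAngle (l * Real.sin ψ)))
        * (2 / (3 * (1 + 2 * (l * Real.sin ψ) ^ 2) * √(1 + (l * Real.sin ψ) ^ 2))) * (l * Real.cos ψ))
      ψ := fun ψ => by
    exact (hasDerivAt_trisectedCurvature (l * Real.sin ψ)).comp ψ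
      ((Real.hasDerivAt_sin ψ).const_mul l)
  have hcos : ∀ ψ ∈ Ioo (-(Real.pi / 2)) (Real.pi / 2), 0 < Real.cos ψ := fun ψ hψ =>
    Real.cos_pos_of_mem_Ioo hψ
  have h := intervalIntegral.integral_comp_mul_deriv_of_deriv_nonneg (a := -(Real.pi / 2))
    (b := Real.pi / 2) (f := fun ψ => trisectedCurvature (l * Real.sin ψ))
    (g := fun x => 6 * √(6 * √3 / (1 + 2 * l ^ 2))
      / ((9 - x ^ 2) * √(-x ^ 3 + 9 * x - 6 * √3 / (1 + 2 * l ^ 2))))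
    (fun ψ _ => (hd ψ).continuousAt.continuousWithinAt) (fun ψ _ => hd ψ)
    (fun ψ hψ => by
      rw [min_eq_left (by linarith), max_eq_right (by linarith)] at hψ
      have h1 := hcos ψ hψ
      have h2 := deriv_trisectedCurvature_factor_pos (l * Real.sin ψ)
      positivity)
  simp only [Real.sin_neg, Real.sin_pi_div_two, mul_neg, mul_one] at h
  rw [← h]
  -- `H` and `J` are the even and odd parts in ψ of the transformed integrand; only `H` survives on
  -- the symmetric interval.
  set H : ℝ → ℝ := fun ψ => √2 * closureKernel (l * Real.sin ψ) with hH
  set J : ℝ → ℝ := fun ψ => √2 * (Real.sin (2 * trisectedAngle (l * Real.sin ψ))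
    / (√3 * Real.cos (3 / 2 * trisectedAngle (l * Real.sin ψ)))) with hJ
  have key : EqOn (fun ψ => ((fun x => 6 * √(6 * √3 / (1 + 2 * l ^ 2))
      / ((9 - x ^ 2) * √(-x ^ 3 + 9 * x - 6 * √3 / (1 + 2 * l ^ 2)))) ∘
      fun ψ => trisectedCurvature (l * Real.sin ψ)) ψ *
      ((3 * Real.cos (trisectedAngle (l * Real.sin ψ)) - √3 * Real.sin (trisectedAngle (l * Real.sin ψ)))
        * (2 / (3 * (1 + 2 * (l * Real.sin ψ) ^ 2) * √(1 + (l * Real.sin ψ) ^ 2))) * (l * Real.cos ψ)))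
      (fun ψ => H ψ + J ψ) (Ioo (-(Real.pi / 2)) (Real.pi / 2)) := by
    intro ψ hψ
    have h1 := hcos ψ hψ
    have h2 : (l * Real.cos ψ) ^ 2 = l ^ 2 - (l * Real.sin ψ) ^ 2 := by
      rw [mul_pow, Real.cos_sq']; ring
    set y := l * Real.sin ψ with hy
    have hk := trisectedCurvature_mul_nine_sub_sq y
    have hk0 := trisectedCurvature_pos y
    set k := trisectedCurvature y with hkdef
    have hk1 : 9 - k ^ 2 = 6 * √3 / ((1 + 2 * y ^ 2) * k) := by
      field_simp at hk ⊢
      linarith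
    -- The cubic is proportional to l² − y² = (l cos ψ)², so its square root cancels the l cos ψ
    -- coming from dy.
    have hk2 : -k ^ 3 + 9 * k - 6 * √3 / (1 + 2 * l ^ 2)
        = 2 * (6 * √3 / (1 + 2 * l ^ 2)) * (l * Real.cos ψ) ^ 2 / (1 + 2 * y ^ 2) := by
      rw [show -k ^ 3 + 9 * k = k * (9 - k ^ 2) by ring, hk, h2]
      field_simp
      ring
    have hR : 0 < √(6 * √3 / (1 + 2 * l ^ 2)) := by positivity
    have hP := sqrt_one_add_two_mul_sq_pos y
    have hP2 := Real.sq_sqrt (one_add_two_mul_sq_pos y).le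
    have hZ : 0 < √(1 + y ^ 2) := by positivity
    -- The second factor is dκ/dτ, so this is half the derivative of κ², a combination of cos 2τ and
    -- sin 2τ.
    have hkC : k * (3 * Real.cos (trisectedAngle y) - √3 * Real.sin (trisectedAngle y))
        = 3 * √3 * Real.cos (2 * trisectedAngle y) + 3 * Real.sin (2 * trisectedAngle y) := by
      have h3 : √3 ^ 2 = 3 := Real.sq_sqrt (by norm_num)
      rw [hkdef, trisectedCurvature, Real.cos_two_mul, Real.sin_two_mul]
      linear_combination -Real.cos (trisectedAngle y) * Real.sin (trisectedAngle y) * h3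
        - 3 * √3 * Real.sin_sq (trisectedAngle y)
    simp only [Function.comp, hH, hJ, closureKernel]
    rw [hk2, hk1, Real.sqrt_div' _ (one_add_two_mul_sq_pos y).le, Real.sqrt_mul (by positivity),
      Real.sqrt_mul (by norm_num), Real.sqrt_sq (by positivity), cos_three_halves_trisectedAngle]
    have h3 : √2 ^ 2 = 2 := Real.sq_sqrt (by norm_num)
    have h4 : 0 < √2 := by positivity
    have h5 : 0 < √3 := by positivity
    rw [← hy]
    generalize √(6 * √3 / (1 + 2 * l ^ 2)) = R at hR ⊢
    generalize √(1 + y ^ 2) = Z at hZ ⊢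
    generalize √(1 + 2 * y ^ 2) = P at hP hP2 ⊢
    rw [← hP2]
    generalize 3 * Real.cos (trisectedAngle y) - √3 * Real.sin (trisectedAngle y) = w at hkC ⊢
    field_simp
    linear_combination 2 * hkC - 3 * (√3 * Real.cos (2 * trisectedAngle y)
      + Real.sin (2 * trisectedAngle y)) * h3
  have hc : Continuous fun ψ => closureKernel (l * Real.sin ψ) := by
    have := continuous_closureKernel
    fun_prop
  have hHc : Continuous H := continuous_const.mul hc
  have hJc : Continuous J := by
    have := continuous_trisectedAngle
    refine continuous_const.mul (Continuous.div (by fun_prop) (by fun_prop) fun ψ => ?_)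
    exact (mul_pos (by positivity) (cos_three_halves_trisectedAngle_pos _)).ne'
  have hHeven : ∀ ψ, H (-ψ) = H ψ := fun ψ => by
    simp only [hH, closureKernel, Real.sin_neg, mul_neg, trisectedAngle_neg, Real.cos_neg]
  have hJodd : ∀ ψ, J (-ψ) = -J ψ := fun ψ => by
    simp only [hJ, Real.sin_neg, mul_neg, trisectedAngle_neg, Real.cos_neg, neg_div]
  have hJ0 : ∫ ψ in (-(Real.pi / 2))..(Real.pi / 2), J ψ = 0 := by
    have e := intervalIntegral.integral_comp_neg (a := -(Real.pi / 2)) (b := Real.pi / 2) J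
    simp only [hJodd, neg_neg, intervalIntegral.integral_neg] at e
    linarith
  rw [intervalIntegral.integral_congr_Ioo_of_le (by linarith) key,
    intervalIntegral.integral_add (hHc.intervalIntegrable _ _) (hJc.intervalIntegrable _ _),
    hJ0, add_zero,
    ← intervalIntegral.integral_add_adjacent_intervals (b := 0) (hHc.intervalIntegrable _ _)
      (hHc.intervalIntegrable _ _)]
  have e := intervalIntegral.integral_comp_neg (a := 0) (b := Real.pi / 2) H
  simp only [hHeven, neg_zero] at e
  rw [← e, monotoneClosure, intervalIntegral.integral_const_mul]
  ring

/-! ### The parameter l as a function of a, and the conclusion -/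

/-- The parameter of the monotone form of the closure function, for a given constant of
integration. -/
def closureParameter (a : ℝ) : ℝ := √((-(3 * √3 / 2) / a - 1) / 2)

section

variable {a : ℝ}

theorem closureParameter_radicand_pos (ha : a ∈ Ioo (-(3 * √3 / 2)) 0) :
    0 < (-(3 * √3 / 2) / a - 1) / 2 := by
  have : 1 < -(3 * √3 / 2) / a := by rw [lt_div_iff_of_neg ha.2]; linarith [ha.1]
  linarith

theorem closureParameter_pos (ha : a ∈ Ioo (-(3 * √3 / 2)) 0) : 0 < closureParameter a :=
  Real.sqrt_pos.2 (closureParameter_radicand_pos ha)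

/-- The parameter l solves 6√3/(1 + 2l²) = −4a, so κ(±l) are the two positive roots belonging to a.
-/
theorem trisectedCurvature_closureParameter (ha : a ∈ Ioo (-(3 * √3 / 2)) 0) :
    trisectedCurvature (closureParameter a) * trisectedCurvature (-closureParameter a)
      * (trisectedCurvature (closureParameter a) + trisectedCurvature (-closureParameter a))
      = -4 * a := by
  have h0 : a ≠ 0 := ha.2.ne
  have h3 : (0 : ℝ) < √3 := by positivity
  rw [trisectedCurvature_mul_add, closureParameter,
    Real.sq_sqrt (closureParameter_radicand_pos ha).le,
    show 1 + 2 * ((-(3 * √3 / 2) / a - 1) / 2) = -(3 * √3 / 2) / a by ring]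
  field_simp
  norm_num

theorem strictMonoOn_closureParameter :
    StrictMonoOn closureParameter (Ioo (-(3 * √3 / 2)) 0) := by
  intro a ha b hb hab
  refine Real.sqrt_lt_sqrt (closureParameter_radicand_pos ha).le ?_
  have h3 : (0 : ℝ) < √3 := by positivity
  have : -(3 * √3 / 2) / a < -(3 * √3 / 2) / b := by
    rw [neg_div, neg_div, ← div_neg, ← div_neg]
    exact div_lt_div_of_pos_left (by positivity) (by linarith [hb.2]) (by linarith)
  linarith

theorem tendsto_closureParameter_left :
    Tendsto closureParameter (𝓝[>] (-(3 * √3 / 2))) (𝓝 0) := by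
  have h3 : (-(3 * √3 / 2) : ℝ) ≠ 0 := by
    have : (0 : ℝ) < √3 := by positivity
    linarith
  -- The formula for l extends continuously to the left endpoint, where its radicand is 0.
  have h : ContinuousAt closureParameter (-(3 * √3 / 2)) := by
    refine ContinuousAt.sqrt ?_
    exact ((continuousAt_const.div continuousAt_id h3).sub continuousAt_const).div_const 2
  have h0 : closureParameter (-(3 * √3 / 2)) = 0 := by simp [closureParameter]
  have := h.tendsto.mono_left (nhdsWithin_le_nhds (s := Ioi (-(3 * √3 / 2))))
  rwa [h0] at this

theorem tendsto_closureParameter_right :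
    Tendsto closureParameter (𝓝[<] 0) atTop := by
  have h3 : (-(3 * √3 / 2) : ℝ) < 0 := by
    have : (0 : ℝ) < √3 := by positivity
    linarith
  refine Real.tendsto_sqrt_atTop.comp (Tendsto.atTop_div_const two_pos ?_)
  refine tendsto_atTop_add_const_right _ _ ?_
  simp only [div_eq_mul_inv]
  exact (tendsto_inv_nhdsLT_zero (𝕜 := ℝ)).const_mul_atBot_of_neg h3

theorem closureFunction_eq_monotoneClosure (ha : a ∈ Ioo (-(3 * √3 / 2)) 0) :
    closureFunction (3 / 2) a = monotoneClosure (closureParameter a) := by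
  have hl := closureParameter_pos ha
  have h := (closureFunction_wellDefined (trisectedCurvature_pos _) (trisectedCurvature_neg_lt hl)
    (trisectedCurvature_sq_add _)).2.2
  rw [trisectedCurvature_closureParameter ha, closureIntegral_eq_monotoneClosure hl] at h
  rw [← h]
  congr 1
  ring

end

theorem aStar_three_halves : aStar (3 / 2) = -(3 * √3 / 2) := by
  have h : (3 / 2 : ℝ) ^ (3 / 2 : ℝ) * (3 / 2 - 1 : ℝ) ^ (1 - 3 / 2 : ℝ) = 3 * √3 / 2 := by
    rw [rpow_three_halves (by norm_num), show (1 - 3 / 2 : ℝ) = -(1 / 2) by norm_num,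
      Real.rpow_neg (by norm_num), ← Real.sqrt_eq_rpow, show (3 / 2 - 1 : ℝ) = 1 / 2 by norm_num,
      pow_succ, Real.sq_sqrt (by norm_num), Real.sqrt_div (by norm_num), Real.sqrt_div (by norm_num),
      Real.sqrt_one]
    have : (0 : ℝ) < √2 := by positivity
    field_simp
  rw [aStar, h]

end

theorem mainTheorem4 :
    -- the domain of the closure function for `p = 3/2`
    aStar (3 / 2) = -(3 * Real.sqrt 3 / 2) ∧
    (∀ a ∈ Set.Ioo (-(3 * Real.sqrt 3 / 2)) 0,
      -- the closure function is well defined: there are curves with constant of integration `a`,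
      -- the curvature has a least period, and all of them give the same value
      (∃ κ : ℝ → ℝ, IsPElasticCurvature (3 / 2) a κ) ∧
      (∀ κ : ℝ → ℝ, IsPElasticCurvature (3 / 2) a κ →
        ∃ ϱ, IsLeastPeriod κ ϱ ∧
          closureFunction (3 / 2) a = angularProgression (3 / 2) a κ ϱ) ∧
      -- the explicit formula
      ∃ α β : ℝ, 0 < β ∧ β < α ∧
        {x : ℝ | 0 < x ∧ (-x ^ 3 + 9 * x + 4 * a) / 4 = 0} = {α, β} ∧
        closureFunction (3 / 2) a =
          2 * Real.sqrt (α * β * (α + β)) / (3 * Real.sqrt (2 * α + β))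
              * ellipticK (zetaMod α β)
            + Real.pi * heumanLambda
                (Real.arcsin (Real.sqrt ((chiChar α β - zetaMod α β ^ 2)
                  / (chiChar α β * (1 - zetaMod α β ^ 2)))))
                (zetaMod α β)) ∧
    -- strict decrease from `√2 π` to `π`
    StrictAntiOn (closureFunction (3 / 2)) (Set.Ioo (-(3 * Real.sqrt 3 / 2)) 0) ∧
    Filter.Tendsto (closureFunction (3 / 2))
      (nhdsWithin (-(3 * Real.sqrt 3 / 2)) (Set.Ioi (-(3 * Real.sqrt 3 / 2))))
      (nhds (Real.sqrt 2 * Real.pi)) ∧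
    Filter.Tendsto (closureFunction (3 / 2)) (nhdsWithin 0 (Set.Iio 0)) (nhds Real.pi) := by
  have hneg : (-(3 * √3 / 2) : ℝ) < 0 := by
    have : (0 : ℝ) < √3 := by positivity
    linarith
  refine ⟨aStar_three_halves, fun a ha => ?_, fun a ha b hb hab => ?_, ?_, ?_⟩
  · have hl := closureParameter_pos ha
    have hc := trisectedCurvature_closureParameter ha
    have hβ := trisectedCurvature_pos (-closureParameter a)
    have hαβ := trisectedCurvature_neg_lt hl
    have h9 := trisectedCurvature_sq_add (closureParameter a)
    generalize trisectedCurvature (closureParameter a) = α at *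
    generalize trisectedCurvature (-closureParameter a) = β at *
    have ha' : a = -(α * β * (α + β)) / 4 := by linarith
    obtain ⟨h1, h2, h3⟩ := closureFunction_wellDefined hβ hαβ h9
    rw [← ha'] at h1 h2 h3
    refine ⟨h1, h2, α, β, hβ, hαβ, ?_, h3.trans (closureIntegral_eq_heumanLambda hβ hαβ h9)⟩
    ext x
    simp only [mem_ofPred_eq, mem_insert_iff, mem_singleton_iff]
    constructor
    · rintro ⟨hx, h⟩
      exact eq_or_eq_of_cubic_eq_zero hβ hαβ h9 hx (by linarith)
    · rintro (rfl | rfl)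
      · exact ⟨hβ.trans hαβ, by linear_combination -(x / 4) * h9 + hc / 4⟩
      · exact ⟨hβ, by linear_combination -(x / 4) * h9 + hc / 4⟩
  · rw [closureFunction_eq_monotoneClosure ha, closureFunction_eq_monotoneClosure hb]
    exact strictAntiOn_monotoneClosure (closureParameter_pos ha).le (closureParameter_pos hb).le
      (strictMonoOn_closureParameter ha hb hab)
  · have h := (continuous_monotoneClosure.tendsto 0).comp tendsto_closureParameter_left
    rw [monotoneClosure_zero] at h
    refine h.congr' ?_
    filter_upwards [Ioo_mem_nhdsGT hneg] with a ha
    exact (closureFunction_eq_monotoneClosure ha).symm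
  · refine (tendsto_monotoneClosure_atTop.comp tendsto_closureParameter_right).congr' ?_
    filter_upwards [Ioo_mem_nhdsLT hneg] with a ha
    exact (closureFunction_eq_monotoneClosure ha).symm
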